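/- Let $n\ge 1$ and $\theta>0$. Let $\mathbb W^n_\theta$ be the set of vectors $(\lambda_1+(n-1)\theta,\lambda_2+(n-2)\theta,\dots,\lambda_n)$ with integers $\lambda_1\ge\lambda_2\ge\cdots\ge\lambda_n\ge 0$. Let $\boldsymbol x(t)=(x_1(t),\dots,x_n(t))$, $t\ge 0$, be a $\beta$-nonintersecting Poisson random walk, $\beta=2\theta$, with arbitrary (deterministic or random) initial data: a càdlàg process that is Markov with respect to a filtration $(\mathcal F_t)_{t\ge0}$, with state space $\mathbb W^n_\theta$ and generator $$\mathcal L^n_\theta f(\boldsymbol x)=\theta n\sum_{i=1}^n\Bigl(\prod_{j\ne i}\frac{x_i-x_j+\theta}{x_i-x_j}\Bigr)\bigl(f(\boldsymbol x+\boldsymbol e_i)-f(\boldsymbol x)\bigr)$$ acting on bounded functions. For $z\in\mathbb C\setminus\mathbb R$ let $$m^n_t(z)=\frac1n\sum_{i=1}^n\frac1{x_i(t)/(\theta n)-z}$$ be the Stieltjes transform of the empirical measure $\mu^n_t=\frac1n\sum_{i}\delta_{x_i(t)/(\theta n)}$. Let $(\mu_t)_{t\ge0}$ be a limiting measure-valued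 process: a weakly càdlàg family of probability measures on $\mathbb R$ with densities bounded by $1$, whose Stieltjes transforms $m_t(z)=\int\frac{d\mu_t(x)}{x-z}$ satisfy $m_t(z)=m_0(z)-\int_0^te^{-m_s(z)}\partial_zm_s(z)\,ds$ for all $t\ge 0$ and $z\in\mathbb C\setminus\mathbb R$. Let $T\ge0$, $z\in\mathbb C$, and let $t\mapsto z_t\in\mathbb C\setminus\mathbb R$, $0\le t\le T$, be a characteristic: $\partial_tz_t=e^{-m_t(z_t)}$, $z_0=z$. Then for all $0\le t\le T$ $$\begin{aligned}m^n_t(z_t)=m^n_0(z)&+\int_0^t\partial_zm^n_s(z_s)\,e^{-m_s(z_s)}\,ds\\&+\theta n\int_0^t\Bigl(\prod_{j=1}^n\Bigl(1+\frac1n\frac1{z_s-x_j(s)/(\theta n)}\Bigr)-\prod_{j=1}^n\Bigl(1+\frac1n\frac1{(z_s-1/(\theta n))-x_j(s)/(\theta n)}\Bigr)\Bigr)ds+M^n_t(z),\end{aligned}$$ where both integrals exist and $(M^n_t(z))_{0\le t\le T}$ is a complex-valued $(\mathcal F_t)$-martingale with $M^n_0(z)=0$ and quadratic variations $$[M^n(z),M^n(z)]_t=\sum_{0\le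 s\le t}\bigl(m^n_s(z_s)-m^n_{s-}(z_s)\bigr)^2,\qquad [M^n(z),\overline{M^n(z)}]_t=\sum_{0\le s\le t}\bigl|m^n_s(z_s)-m^n_{s-}(z_s)\bigr|^2$$ for $0\le t\le T$. Here the sums converge absolutely, $m^n_{s-}(z_s)=\lim_{u\uparrow s}m^n_u(z_s)$ for $s>0$ and $m^n_{0-}=m^n_0$. The bracket $[M,N]$ is the limit in probability, uniformly in $t\le T$, of $\sum_i(M_{t_{i+1}\wedge t}-M_{t_i\wedge t})(N_{t_{i+1}\wedge t}-N_{t_i\wedge t})$ along every sequence of deterministic partitions of $[0,T]$ with mesh tending to $0$. -/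

import Mathlib

open MeasureTheory ProbabilityTheory Filter Topology
open scoped NNReal ENNReal

noncomputable section

namespace BetaWalk

/-- Right-continuous functions with left limits on `[0, ∞)`. At `t = 0` the left-limit clause is
void, because the left neighbourhood filter of `0` in `ℝ≥0` is trivial. -/
def IsCadlag {E : Type*} [TopologicalSpace E] (f : ℝ≥0 → E) : Prop :=
  ∀ t : ℝ≥0, ContinuousWithinAt f (Set.Ici t) t ∧ ∃ l : E, Tendsto f (𝓝[<] t) (𝓝 l)

/-- The state space `𝕎ⁿ_θ`: configurations
`(λ₁ + (n-1)θ, λ₂ + (n-2)θ, …, λₙ)` with integers `λ₁ ≥ λ₂ ≥ ⋯ ≥ λₙ ≥ 0`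
(the indices are shifted to `0, …, n-1`). -/
def chamber (n : ℕ) (θ : ℝ) : Set (Fin n → ℝ) :=
  {x | ∃ l : Fin n → ℕ, Antitone l ∧ ∀ i, x i = (l i : ℝ) + ((n : ℝ) - 1 - (i : ℕ)) * θ}

/-- The rate `θ n ∏_{j ≠ i} (x_i - x_j + θ) / (x_i - x_j)` of the jump `x ↦ x + e_i`. -/
def rate {n : ℕ} (θ : ℝ) (x : Fin n → ℝ) (i : Fin n) : ℝ :=
  θ * n * ∏ j ∈ Finset.univ.erase i, (x i - x j + θ) / (x i - x j)

/-- The generator `f ↦ ∑ᵢ rateᵢ(x) (f(x + eᵢ) - f(x))`. For `x` in the chamber the value at `x` only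
depends on `f` on the chamber: a jump that would leave the chamber has rate zero. -/
def generator {n : ℕ} (θ : ℝ) (f : (Fin n → ℝ) → ℝ) (x : Fin n → ℝ) : ℝ :=
  ∑ i, rate θ x i * (f (x + Pi.single i 1) - f x)

/-- `κ` is a Markov transition semigroup on the chamber whose infinitesimal generator, on the space
of bounded functions with the supremum norm, is `generator θ`.
(The chamber is countable and discrete, so every function on it is measurable.) -/
structure IsTransitionSemigroup {n : ℕ} (θ : ℝ)
    (κ : ℝ≥0 → Kernel (chamber n θ) (chamber n θ)) : Prop where
  markov : ∀ t, IsMarkovKernel (κ t)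
  zero : κ 0 = Kernel.id
  add : ∀ s t, κ (s + t) = κ t ∘ₖ κ s
  generator_eq : ∀ f : (Fin n → ℝ) → ℝ, (∃ C, ∀ x, |f x| ≤ C) →
    TendstoUniformly
      (fun (h : ℝ≥0) (x : chamber n θ) => ((∫ y, f y ∂(κ h x)) - f x) / (h : ℝ))
      (fun x => generator θ f x) (𝓝[>] 0)

/-- `X` is a `β`-nonintersecting Poisson random walk (`β = 2θ`) with respect to the filtration `ℱ`:
a càdlàg Markov process on the chamber with generator `generator θ`. The initial configuration
`X 0` is arbitrary, deterministic or random. -/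
structure IsWalk {Ω : Type*} {mΩ : MeasurableSpace Ω} {n : ℕ} (θ : ℝ) (P : Measure Ω)
    (ℱ : Filtration ℝ≥0 mΩ) (X : ℝ≥0 → Ω → chamber n θ) : Prop where
  adapted : StronglyAdapted ℱ X
  cadlag : ∀ ω, IsCadlag (fun t => X t ω)
  markov : ∃ κ : ℝ≥0 → Kernel (chamber n θ) (chamber n θ), IsTransitionSemigroup θ κ ∧
    ∀ f : (Fin n → ℝ) → ℝ, (∃ C, ∀ x, |f x| ≤ C) → ∀ s t : ℝ≥0,
      P[fun ω => f (X (s + t) ω) | ℱ s] =ᵐ[P] fun ω => ∫ y, f y ∂(κ t (X s ω))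

/-- The Stieltjes transform `m(z) = ∫ dμ(x) / (x - z)`; see `stieltjes_eq` for this formula. -/
def stieltjes (μ : Measure ℝ) (z : ℂ) : ℂ := resolventTransform μ z

theorem stieltjes_eq (μ : Measure ℝ) (z : ℂ) : stieltjes μ z = ∫ x : ℝ, 1 / ((x : ℂ) - z) ∂μ := by
  simp [stieltjes, resolventTransform_apply, resolvent]

/-- The empirical measure `(1/n) ∑ᵢ δ_{xᵢ / (θ n)}` of a configuration. -/
def empirical {n : ℕ} (θ : ℝ) (x : Fin n → ℝ) : Measure ℝ :=
  (n : ℝ≥0∞)⁻¹ • ∑ i, Measure.dirac (x i / (θ * n))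

/-- The limiting measure-valued process: a càdlàg path of probability measures (weak topology)
with densities bounded by `1`, whose Stieltjes transforms solve
`m_t(z) = m_0(z) - ∫₀ᵗ e^{-m_s(z)} ∂_z m_s(z) ds` off the real line. -/
structure IsLimitFlow (μ : ℝ≥0 → ProbabilityMeasure ℝ) : Prop where
  cadlag : IsCadlag μ
  density_le_one : ∀ t, (μ t : Measure ℝ) ≤ volume
  burgers : ∀ (t : ℝ≥0) (z : ℂ), z.im ≠ 0 →
    stieltjes (μ t) z = stieltjes (μ 0) z -
      ∫ s in (0 : ℝ)..t, Complex.exp (-stieltjes (μ s.toNNReal) z) *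
        deriv (stieltjes (μ s.toNNReal)) z

/-- `ζ` is the characteristic curve `s ↦ z_s` issued from `z`, on the time interval `[0, T]`:
it stays off the real line and solves `∂_t z_t = e^{-m_t(z_t)}`, `z_0 = z`. -/
structure IsCharacteristic (μ : ℝ≥0 → ProbabilityMeasure ℝ) (T : ℝ≥0) (z : ℂ) (ζ : ℝ → ℂ) :
    Prop where
  zero : ζ 0 = z
  im_ne_zero : ∀ t ∈ Set.Icc (0 : ℝ) T, (ζ t).im ≠ 0
  hasDeriv : ∀ t ∈ Set.Icc (0 : ℝ) T,
    HasDerivWithinAt ζ (Complex.exp (-stieltjes (μ t.toNNReal) (ζ t))) (Set.Icc 0 T) t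

/-- `V` is the quadratic covariation `[M, N]` on `[0, T]` (for `M`, `N` starting at `0`): along every
sequence of partitions `0 = π_k(0) ≤ ⋯ ≤ π_k(L_k) = T` with mesh tending to `0`, the sums of products
of increments up to time `t` converge to `V t`, uniformly for `t ≤ T`, in probability. -/
def IsQuadraticCovariation {Ω : Type*} [MeasurableSpace Ω] (P : Measure Ω) (T : ℝ≥0)
    (M N V : ℝ≥0 → Ω → ℂ) : Prop :=
  ∀ (L : ℕ → ℕ) (π : ℕ → ℕ → ℝ≥0),
    (∀ k, Monotone (π k)) → (∀ k, π k 0 = 0) → (∀ k, π k (L k) = T) →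
    (∀ δ : ℝ≥0, 0 < δ → ∀ᶠ k in atTop, ∀ i < L k, π k (i + 1) ≤ π k i + δ) →
    ∀ ε : ℝ, 0 < ε → Tendsto (fun k => P {ω | ∃ t ≤ T, ε ≤
      ‖(∑ i ∈ Finset.range (L k),
        (M (min (π k (i + 1)) t) ω - M (min (π k i) t) ω) *
          (N (min (π k (i + 1)) t) ω - N (min (π k i) t) ω)) - V t ω‖}) atTop (𝓝 0)

/-- The jump `m^n_s(w) - m^n_{s-}(w)` at time `s` of the Stieltjes transform of the empirical
measure, along a path `x` of configurations, at a fixed spectral parameter `w`.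
At `s = 0`, `Function.leftLim` returns the value itself, which is the convention `0- = 0`. -/
def stieltjesJump {n : ℕ} (θ : ℝ) (x : ℝ≥0 → chamber n θ) (w : ℂ) (s : ℝ≥0) : ℂ :=
  stieltjes (empirical (n := n) θ (x s)) w -
    Function.leftLim (fun u => stieltjes (empirical (n := n) θ (x u)) w) s

/-- `θ n (∏ⱼ (1 + (1/n) / (w - xⱼ/(θn))) - ∏ⱼ (1 + (1/n) / ((w - 1/(θn)) - xⱼ/(θn))))`. -/
def nekrasovDrift {n : ℕ} (θ : ℝ) (x : Fin n → ℝ) (w : ℂ) : ℂ :=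
  (θ : ℂ) * n *
    (∏ j, (1 + 1 / (n : ℂ) * (1 / (w - (x j : ℂ) / (θ * n)))) -
      ∏ j, (1 + 1 / (n : ℂ) * (1 / ((w - 1 / (θ * n)) - (x j : ℂ) / (θ * n)))))

end BetaWalk

end

/-! The martingale is Dynkin's martingale of a time-dependent function. Put F(s, x) for the
Stieltjes transform of the empirical measure of x at the point z_s. On the compact interval [0, T]
the characteristic stays at a positive distance from the real line, so F is bounded, uniformly
Lipschitz in s and right-differentiable in s. Hence F(t, X_t) - F(0, X_0) - ∫₀ᵗ (∂_s F + LF)(s, X_s)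
ds should be a martingale, and it remains to compute the two drift terms and the brackets.

Drift. By the chain rule ∂_s F is ∂_z m^n times the velocity e^{-m_s(z_s)}. For LF, a jump of
particle i changes a single term of the Stieltjes sum. In the variable y = θ n z, the rate of this
jump divided by n is the residue at x_i of ∏ (y - x_j + θ) / (y - x_j). Partial fractions
(`prod_shift_div_eq`) at y and at y - 1 therefore turn LF into the difference of two products
(`complexGenerator_stieltjes`).

Martingale property. The generator is given as a derivative of the semigroup at time 0, uniform in
the starting state. The Markov property transports this to any time r and any event A of ℱ r with
the same error (`IsWalk.increment`). Consequently r ↦ E[F(r, X_r); A] is continuous with right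
derivative E[(∂_s F + LF)(r, X_r); A], and integrating it gives Dynkin's formula on A
(`IsWalk.setIntegral_dynkin`), which characterizes the conditional expectation.

Brackets. The chamber is discrete, so a càdlàg path has finitely many jumps up to T and is constant
between them. The integral of ∂_s F cancels the evolution of F between jumps, so each path of M is a
finite step path, with the jumps of m^n, plus a Lipschitz path
(`IsWalk.isStepLipschitz_dynkinMartingale`). For such paths the sums of products of increments
converge pathwise, uniformly in t, to the sum of products of jumps. Pathwise convergence gives
convergence in probability, once the supremum over t is controlled through countably many times. -/

noncomputable section

namespace BetaWalk

/-! ### Geometry of the chamber and bounds on the jump rates. -/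

section Chamber

variable {n : ℕ} {θ : ℝ}

theorem chamber_countable (n : ℕ) (θ : ℝ) : (chamber n θ).Countable := by
  refine (Set.countable_range (fun (l : Fin n → ℕ) (i : Fin n) =>
    (l i : ℝ) + ((n : ℝ) - 1 - (i : ℕ)) * θ)).mono ?_
  rintro x ⟨l, -, hl⟩
  exact ⟨l, (funext hl).symm⟩

instance : Countable (chamber n θ) := (chamber_countable n θ).to_subtype

/-- Two distinct configurations differ by a nonzero integer in some coordinate, so they are at
distance at least 1. Discreteness is what makes càdlàg paths piecewise constant. -/
instance : DiscreteTopology (chamber n θ) := by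
  refine DiscreteTopology.of_forall_le_dist one_pos ?_
  intro x' y' hxy
  obtain ⟨l, -, hl⟩ := x'.2
  obtain ⟨k, -, hk⟩ := y'.2
  obtain ⟨i, hi⟩ : ∃ i, l i ≠ k i := by
    by_contra! h
    exact hxy (Subtype.ext (funext fun i => by rw [hl, hk, h]))
  have h1 : dist (x'.1 i) (y'.1 i) ≤ dist x'.1 y'.1 := dist_le_pi_dist _ _ i
  refine le_trans ?_ h1
  rw [hl, hk, Real.dist_eq, add_sub_add_right_eq_sub]
  have : (1 : ℤ) ≤ |(l i : ℤ) - k i| := Int.one_le_abs (sub_ne_zero.2 (by exact_mod_cast hi))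
  exact_mod_cast this

theorem le_abs_sub_of_mem_chamber (hθ : 0 < θ) {x : Fin n → ℝ} (hx : x ∈ chamber n θ) {i j : Fin n}
    (hij : i ≠ j) : θ ≤ |x i - x j| := by
  obtain ⟨l, hl, h⟩ := hx
  wlog hlt : i < j generalizing i j
  · rw [abs_sub_comm]
    exact this hij.symm (lt_of_le_of_ne (not_lt.1 hlt) hij.symm)
  have h1 : (l j : ℝ) ≤ l i := by exact_mod_cast hl hlt.le
  have h2 : ((i : ℕ) : ℝ) + 1 ≤ (j : ℕ) := by exact_mod_cast hlt
  refine le_trans ?_ (le_abs_self _)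
  rw [h, h]
  nlinarith

theorem injective_of_mem_chamber (hθ : 0 < θ) {x : Fin n → ℝ} (hx : x ∈ chamber n θ) :
    Function.Injective x := by
  intro i j hij
  by_contra hne
  have := le_abs_sub_of_mem_chamber hθ hx hne
  rw [hij, sub_self, abs_zero] at this
  linarith

/-- Distinct particles are at least θ apart, so each factor of the rate is at most 2 in absolute
value. Bounded rates make the generator bounded on bounded functions, the source of the
integrability and Lipschitz estimates below. -/
theorem abs_rate_le (hθ : 0 < θ) {x : Fin n → ℝ} (hx : x ∈ chamber n θ) (i : Fin n) :
    |rate θ x i| ≤ θ * n * 2 ^ n := by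
  rw [rate, abs_mul, abs_of_nonneg (by positivity : 0 ≤ θ * n), Finset.abs_prod]
  gcongr
  calc ∏ j ∈ Finset.univ.erase i, |(x i - x j + θ) / (x i - x j)|
      ≤ ∏ j ∈ Finset.univ.erase i, (2 : ℝ) := by
        refine Finset.prod_le_prod (fun _ _ => abs_nonneg _) fun j hj => ?_
        have h := le_abs_sub_of_mem_chamber hθ hx (Finset.ne_of_mem_erase hj).symm
        rw [abs_div, div_le_iff₀ (by linarith)]
        calc |x i - x j + θ| ≤ |x i - x j| + |θ| := abs_add_le _ _
          _ ≤ 2 * |x i - x j| := by rw [abs_of_pos hθ]; linarith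
    _ ≤ 2 ^ n := by
        rw [Finset.prod_const]
        exact pow_le_pow_right₀ one_le_two ((Finset.card_le_univ _).trans_eq (Fintype.card_fin n))

/-- The generator acting on complex-valued functions. -/
def complexGenerator (θ : ℝ) (f : (Fin n → ℝ) → ℂ) (x : Fin n → ℝ) : ℂ :=
  ∑ i, (rate θ x i : ℂ) * (f (x + Pi.single i 1) - f x)

theorem complexGenerator_re (f : (Fin n → ℝ) → ℂ) (x : Fin n → ℝ) :
    (complexGenerator θ f x).re = generator θ (fun y => (f y).re) x := by
  simp [complexGenerator, generator]

theorem complexGenerator_im (f : (Fin n → ℝ) → ℂ) (x : Fin n → ℝ) :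
    (complexGenerator θ f x).im = generator θ (fun y => (f y).im) x := by
  simp [complexGenerator, generator]

theorem norm_complexGenerator_le (hθ : 0 < θ) {f : (Fin n → ℝ) → ℂ} {C : ℝ} (hf : ∀ x, ‖f x‖ ≤ C)
    {x : Fin n → ℝ} (hx : x ∈ chamber n θ) :
    ‖complexGenerator θ f x‖ ≤ n * ((θ * n * 2 ^ n) * (C + C)) := by
  refine (norm_sum_le _ _).trans ?_
  calc ∑ i, ‖(rate θ x i : ℂ) * (f (x + Pi.single i 1) - f x)‖
      ≤ ∑ _i : Fin n, (θ * n * 2 ^ n) * (C + C) := by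
        refine Finset.sum_le_sum fun i _ => ?_
        rw [norm_mul, Complex.norm_real]
        exact mul_le_mul (abs_rate_le hθ hx i)
          ((norm_sub_le _ _).trans (add_le_add (hf _) (hf _))) (norm_nonneg _) (by positivity)
    _ = _ := by simp

end Chamber

/-! ### The generator on Stieltjes transforms, by partial fractions. -/

/-- Partial fractions of `∏ (y - x_j + θ) / (y - x_j)`. -/
theorem prod_shift_div_eq {n : ℕ} {x : Fin n → ℂ} (hx : Function.Injective x) (θ y : ℂ)
    (hy : ∀ i, y ≠ x i) :
    ∏ j, (y - x j + θ) / (y - x j) =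
      1 + ∑ i, θ * (∏ j ∈ Finset.univ.erase i, (x i - x j + θ) / (x i - x j)) * (y - x i)⁻¹ := by
  classical
  -- Both nodal polynomials are monic of degree n, so their difference has degree below n and is
  -- recovered by Lagrange interpolation at the x_i, where the second product vanishes.
  set f : Polynomial ℂ :=
    Lagrange.nodal Finset.univ (fun j => x j - θ) - Lagrange.nodal Finset.univ x with hf
  have hev : ∀ w, f.eval w = (∏ j, (w - x j + θ)) - ∏ j, (w - x j) := by
    intro w
    simp [hf, Lagrange.eval_nodal, sub_add]
  have hdeg : f.degree < (Finset.univ : Finset (Fin n)).card := by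
    have := Polynomial.degree_sub_lt_left
      (Lagrange.degree_nodal.trans Lagrange.degree_nodal.symm :
        (Lagrange.nodal Finset.univ (fun j => x j - θ)).degree =
          (Lagrange.nodal Finset.univ x).degree)
      Lagrange.nodal_ne_zero
      (by rw [Lagrange.nodal_monic.leadingCoeff, Lagrange.nodal_monic.leadingCoeff])
    rwa [Lagrange.degree_nodal] at this
  have key := Lagrange.eq_interpolate (s := Finset.univ) (v := x) hx.injOn hdeg
  have h3 := congrArg (Polynomial.eval y) key
  rw [Lagrange.eval_interpolate_not_at_node _ (fun i _ => hy i), hev, Lagrange.eval_nodal] at h3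
  have hne : ∏ j, (y - x j) ≠ 0 := Finset.prod_ne_zero_iff.2 fun j _ => sub_ne_zero.2 (hy j)
  rw [Finset.prod_div_distrib, div_eq_iff hne]
  rw [sub_eq_iff_eq_add] at h3
  rw [h3, add_mul, one_mul, add_comm, mul_comm]
  congr 2
  refine Finset.sum_congr rfl fun i _ => ?_
  rw [hev, Finset.prod_eq_zero (f := fun j => x i - x j) (Finset.mem_univ i) (sub_self _), sub_zero,
    ← Finset.mul_prod_erase _ _ (Finset.mem_univ i), sub_self, zero_add, Lagrange.nodalWeight,
    Finset.prod_div_distrib, Finset.prod_inv_distrib, div_eq_mul_inv]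
  ring

section StieltjesEmpirical

variable {n : ℕ} {θ : ℝ}

theorem stieltjes_empirical (x : Fin n → ℝ) (w : ℂ) :
    stieltjes (empirical θ x) w = (n : ℂ)⁻¹ * ∑ i, (((x i / (θ * n) : ℝ) : ℂ) - w)⁻¹ := by
  rw [stieltjes_eq, empirical, integral_smul_measure,
    integral_finsetSum_measure fun i _ => integrable_dirac enorm_lt_top]
  simp [integral_dirac]

theorem le_norm_ofReal_sub (a : ℝ) {w : ℂ} {c : ℝ} (hw : c ≤ |w.im|) : c ≤ ‖(a : ℂ) - w‖ := by
  refine hw.trans ?_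
  have := Complex.abs_im_le_norm ((a : ℂ) - w)
  simpa using this

theorem ofReal_sub_ne_zero (a : ℝ) {w : ℂ} (hw : w.im ≠ 0) : (a : ℂ) - w ≠ 0 := by
  have := le_norm_ofReal_sub a (le_refl |w.im|)
  exact norm_pos_iff.1 ((abs_pos.2 hw).trans_le this)

theorem norm_inv_mul_sum_le (a : Fin n → ℂ) {C : ℝ} (hC : 0 ≤ C) (ha : ∀ i, ‖a i‖ ≤ C) :
    ‖(n : ℂ)⁻¹ * ∑ i, a i‖ ≤ C := by
  rcases Nat.eq_zero_or_pos n with rfl | hn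
  · simpa using hC
  have hn' : (0 : ℝ) < n := by exact_mod_cast hn
  rw [norm_mul, norm_inv, Complex.norm_natCast, inv_mul_le_iff₀ hn']
  refine (norm_sum_le _ _).trans ((Finset.sum_le_sum fun i _ => ha i).trans ?_)
  simp

theorem norm_stieltjes_empirical_le (x : Fin n → ℝ) {w : ℂ} {c : ℝ} (hc : 0 < c)
    (hw : c ≤ |w.im|) : ‖stieltjes (empirical θ x) w‖ ≤ c⁻¹ := by
  rw [stieltjes_empirical]
  refine norm_inv_mul_sum_le _ (by positivity) fun i => ?_
  rw [norm_inv]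
  exact inv_anti₀ hc (le_norm_ofReal_sub _ hw)

theorem norm_stieltjes_empirical_sub_le (x : Fin n → ℝ) {w v : ℂ} {c : ℝ} (hc : 0 < c)
    (hw : c ≤ |w.im|) (hv : c ≤ |v.im|) :
    ‖stieltjes (empirical θ x) w - stieltjes (empirical θ x) v‖ ≤ (c⁻¹ * c⁻¹) * ‖w - v‖ := by
  rw [stieltjes_empirical, stieltjes_empirical, ← mul_sub, ← Finset.sum_sub_distrib]
  refine norm_inv_mul_sum_le _ (by positivity) fun i => ?_
  have h1 := le_norm_ofReal_sub (x i / (θ * n)) hw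
  have h2 := le_norm_ofReal_sub (x i / (θ * n)) hv
  rw [inv_sub_inv (norm_pos_iff.1 (hc.trans_le h1)) (norm_pos_iff.1 (hc.trans_le h2)),
    sub_sub_sub_cancel_left, norm_div, norm_mul, div_eq_mul_inv, mul_inv, mul_comm]
  gcongr

theorem differentiableAt_stieltjes_empirical (x : Fin n → ℝ) {w : ℂ} (hw : w.im ≠ 0) :
    DifferentiableAt ℂ (stieltjes (empirical θ x)) w := by
  have : stieltjes (empirical θ x) =
      fun w => (n : ℂ)⁻¹ * ∑ i, (((x i / (θ * n) : ℝ) : ℂ) - w)⁻¹ :=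
    funext (stieltjes_empirical x)
  rw [this]
  refine (DifferentiableAt.fun_sum fun i _ => ?_).const_mul _
  exact ((differentiableAt_const _).sub differentiableAt_id).inv (ofReal_sub_ne_zero _ hw)

/-- The generator applied to the Stieltjes transform of the empirical measure. -/
theorem complexGenerator_stieltjes (hn : 0 < n) (hθ : 0 < θ) {x : Fin n → ℝ}
    (hx : x ∈ chamber n θ) {w : ℂ} (hw : w.im ≠ 0) :
    complexGenerator θ (fun y => stieltjes (empirical θ y) w) x = nekrasovDrift θ x w := by
  have hn' : (n : ℂ) ≠ 0 := by exact_mod_cast hn.ne'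
  have hθ' : (θ : ℂ) ≠ 0 := by exact_mod_cast hθ.ne'
  have hinj : Function.Injective fun i => (x i : ℂ) :=
    Complex.ofReal_injective.comp (injective_of_mem_chamber hθ hx)
  -- In this variable the factors of the two products are (y - x_j + θ) / (y - x_j) and the same at
  -- y - 1. Both products get the same partial fraction coefficients, rate divided by n, and the
  -- constant terms 1 cancel.
  set y : ℂ := θ * n * w with hy
  have hyim : y.im ≠ 0 := by
    have : y.im = θ * n * w.im := by
      rw [hy, show (θ : ℂ) * n = ((θ * n : ℝ) : ℂ) by push_cast; rfl, Complex.im_ofReal_mul]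
    rw [this]
    positivity
  have hy0 : ∀ a : ℝ, y - a ≠ 0 := fun a => by
    rw [← neg_ne_zero, neg_sub]
    exact ofReal_sub_ne_zero a hyim
  have hy1 : ∀ a : ℝ, y - 1 - a ≠ 0 := fun a => by
    have := hy0 (1 + a)
    push_cast at this
    rwa [sub_sub]
  have e1 : ∀ a : ℝ, 1 + 1 / (n : ℂ) * (1 / (w - (a : ℂ) / (θ * n))) = (y - a + θ) / (y - a) := by
    intro a
    have h : w - (a : ℂ) / (θ * n) = (y - a) / (θ * n) := by rw [hy]; field_simp
    rw [h]
    have := hy0 a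
    field_simp
  have e2 : ∀ a : ℝ, 1 + 1 / (n : ℂ) * (1 / ((w - 1 / (θ * n)) - (a : ℂ) / (θ * n))) =
      (y - 1 - a + θ) / (y - 1 - a) := by
    intro a
    have h : w - 1 / (θ * n) - (a : ℂ) / (θ * n) = (y - 1 - a) / (θ * n) := by rw [hy]; field_simp
    rw [h]
    have := hy1 a
    field_simp
  have e3 : ∀ a : ℝ, (((a / (θ * n) : ℝ) : ℂ) - w)⁻¹ = - (θ * n * (y - a)⁻¹) := by
    intro a
    have h : ((a / (θ * n) : ℝ) : ℂ) - w = - ((y - a) / (θ * n)) := by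
      rw [hy]; push_cast; field_simp; ring
    rw [h]
    have := hy0 a
    field_simp
  rw [nekrasovDrift]
  simp_rw [e1, e2]
  rw [prod_shift_div_eq hinj θ y fun i h => hy0 (x i) (sub_eq_zero.2 h),
    prod_shift_div_eq hinj θ (y - 1) fun i h => hy1 (x i) (sub_eq_zero.2 h), add_sub_add_left_eq_sub,
    ← Finset.sum_sub_distrib, complexGenerator, Finset.mul_sum]
  refine Finset.sum_congr rfl fun i _ => ?_
  simp_rw [stieltjes_empirical]
  rw [← mul_sub, ← Finset.sum_sub_distrib, Finset.sum_eq_single i]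
  · rw [e3, e3, rate]
    -- Moving particle i up by 1 acts on its term like moving y down by 1; this is where the shift
    -- in the second product comes from.
    have h : y - ((x + Pi.single i 1 : Fin n → ℝ) i : ℝ) = y - 1 - x i := by
      simp; ring
    rw [h]
    push_cast
    field_simp
    ring
  · intro j _ hj
    simp [hj]
  · simp

end StieltjesEmpirical

/-! ### Measurability of the walk and its short-time increments. -/

/-- A right-continuous family of measurable maps is jointly measurable. -/
theorem measurable_uncurry_of_rightContinuous {Ω E : Type*} [MeasurableSpace Ω]
    [TopologicalSpace E] [TopologicalSpace.PseudoMetrizableSpace E] [MeasurableSpace E]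
    [BorelSpace E] {Y : ℝ≥0 → Ω → E} (hY : ∀ t, Measurable (Y t))
    (hr : ∀ ω t, ContinuousWithinAt (fun s => Y s ω) (Set.Ici t) t) :
    Measurable fun p : ℝ≥0 × Ω => Y p.1 p.2 := by
  -- Grid points approaching t from above: the `+ 1` after the floor gives t ≤ d k t, so
  -- right-continuity applies.
  set d : ℕ → ℝ≥0 → ℝ≥0 := fun k t => ((⌊t * (k + 1)⌋₊ : ℝ≥0) + 1) / (k + 1) with hd
  have hd1 : ∀ k t, t ≤ d k t := fun k t => by
    rw [hd, le_div_iff₀ (by positivity)]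
    exact (Nat.lt_floor_add_one _).le
  have hd2 : ∀ k t, d k t ≤ t + 1 / ((k : ℝ≥0) + 1) := fun k t => by
    rw [hd, div_le_iff₀ (by positivity), add_mul, one_div,
      inv_mul_cancel₀ (by positivity : (k : ℝ≥0) + 1 ≠ 0)]
    gcongr
    exact Nat.floor_le (zero_le)
  have gen : ∀ (q : ℕ → ℝ≥0) (m : ℝ≥0 → ℕ), Measurable m →
      Measurable fun p : ℝ≥0 × Ω => Y (q (m p.1)) p.2 := by
    intro q m hm
    have h1 : Measurable fun p : ℕ × Ω => Y (q p.1) p.2 :=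
      measurable_from_prod_countable_right fun m => hY (q m)
    exact h1.comp ((hm.comp measurable_fst).prodMk measurable_snd)
  refine measurable_of_tendsto_metrizable (f := fun k (p : ℝ≥0 × Ω) => Y (d k p.1) p.2) ?_ ?_
  · intro k
    exact gen (fun m => ((m : ℝ≥0) + 1) / (k + 1)) (fun t => ⌊t * (k + 1)⌋₊)
      (Nat.measurable_floor.comp (measurable_id.mul_const _))
  · rw [tendsto_pi_nhds]
    rintro ⟨t, ω⟩
    refine (hr ω t).tendsto.comp (tendsto_nhdsWithin_iff.2 ⟨?_, .of_forall fun k => hd1 k t⟩)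
    refine tendsto_of_tendsto_of_tendsto_of_le_of_le tendsto_const_nhds ?_ (fun k => hd1 k t)
      (fun k => hd2 k t)
    have := (tendsto_one_div_add_atTop_nhds_zero_nat (𝕜 := ℝ≥0)).const_add t
    simpa using this

section Walk

variable {Ω : Type*} {mΩ : MeasurableSpace Ω} {n : ℕ} {θ : ℝ} {P : Measure Ω}
  {ℱ : Filtration ℝ≥0 mΩ} {X : ℝ≥0 → Ω → chamber n θ}

theorem IsWalk.measurable_adapted (hX : IsWalk θ P ℱ X) (t : ℝ≥0) : Measurable[ℱ t] (X t) :=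
  (hX.adapted t).measurable

theorem IsWalk.measurable (hX : IsWalk θ P ℱ X) (t : ℝ≥0) : Measurable (X t) :=
  (hX.measurable_adapted t).mono (ℱ.le t) le_rfl

theorem IsWalk.measurable_comp (hX : IsWalk θ P ℱ X) (t : ℝ≥0) {E : Type*} [MeasurableSpace E]
    (f : (Fin n → ℝ) → E) : Measurable fun ω => f (X t ω) :=
  (Measurable.of_discrete (f := fun x : chamber n θ => f x)).comp (hX.measurable t)

/-- Capping the time at t leaves only variables measurable for ℱ t. This is progressive
measurability, needed for time integrals along the path to be adapted. -/
theorem IsWalk.measurable_prod_min (hX : IsWalk θ P ℱ X) (t : ℝ≥0) :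
    @Measurable (ℝ × Ω) _ (@Prod.instMeasurableSpace ℝ Ω _ (ℱ t)) _
      fun p : ℝ × Ω => X (min p.1.toNNReal t) p.2 := by
  let _ : MeasurableSpace Ω := ℱ t
  have h : Measurable fun p : ℝ≥0 × Ω => X (min p.1 t) p.2 := by
    refine measurable_uncurry_of_rightContinuous (Y := fun s => X (min s t)) (fun s => ?_) ?_
    · exact (hX.measurable_adapted _).mono (ℱ.mono (min_le_right s t)) le_rfl
    · intro ω s
      have h1 := (hX.cadlag ω (min s t)).1
      exact h1.comp (t := Set.Ici (min s t)) (f := fun r => min r t)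
        (continuous_id.min continuous_const).continuousWithinAt
        fun r hr => min_le_min_right t hr
  exact h.comp ((measurable_real_toNNReal.comp measurable_fst).prodMk measurable_snd)

theorem IsWalk.measurable_prod (hX : IsWalk θ P ℱ X) :
    Measurable fun p : ℝ × Ω => X p.1.toNNReal p.2 := by
  have h : Measurable fun p : ℝ≥0 × Ω => X p.1 p.2 :=
    measurable_uncurry_of_rightContinuous hX.measurable fun ω t => (hX.cadlag ω t).1
  exact h.comp ((measurable_real_toNNReal.comp measurable_fst).prodMk measurable_snd)

/-- The state space is countable, so joint measurability of G only needs measurability in time for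
each state. -/
theorem IsWalk.measurable_field (hX : IsWalk θ P ℱ X) {G : ℝ → (Fin n → ℝ) → ℂ}
    (hG : ∀ x, Measurable fun s => G s x) :
    Measurable fun p : ℝ × Ω => G p.1 (X p.1.toNNReal p.2) := by
  have h : Measurable fun p : ℝ × chamber n θ => G p.1 p.2 :=
    measurable_from_prod_countable_left fun x => hG x
  exact h.comp (measurable_fst.prodMk hX.measurable_prod)

theorem IsWalk.intervalIntegrable (hX : IsWalk θ P ℱ X) {G : ℝ → (Fin n → ℝ) → ℂ} {B : ℝ}
    (hG : ∀ x, Measurable fun s => G s x) (hB : ∀ s, ∀ x ∈ chamber n θ, ‖G s x‖ ≤ B) (ω : Ω)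
    (a b : ℝ) : IntervalIntegrable (fun s => G s (X s.toNNReal ω)) volume a b := by
  refine (intervalIntegrable_const (c := B)).mono_fun ?_ ?_
  · exact ((hX.measurable_field hG).comp measurable_prodMk_right).aestronglyMeasurable
  · refine .of_forall fun s => (hB s _ (X _ ω).2).trans ?_
    exact le_abs_self B

theorem IsWalk.stronglyMeasurable_integral (hX : IsWalk θ P ℱ X) {G : ℝ → (Fin n → ℝ) → ℂ}
    (hG : ∀ x, Measurable fun s => G s x) (t : ℝ≥0) :
    StronglyMeasurable[ℱ t] fun ω => ∫ s in (0 : ℝ)..t, G s (X s.toNNReal ω) := by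
  have heq : (fun ω => ∫ s in (0 : ℝ)..t, G s (X s.toNNReal ω)) =
      fun ω => ∫ s in Set.Ioc (0 : ℝ) t, G s (X (min s.toNNReal t) ω) := by
    funext ω
    rw [intervalIntegral.integral_of_le t.coe_nonneg]
    refine setIntegral_congr_fun measurableSet_Ioc fun s hs => ?_
    have : min s.toNNReal t = s.toNNReal := min_eq_left (Real.toNNReal_le_iff_le_coe.2 hs.2)
    simp only [this]
  rw [heq]
  have hm := hX.measurable_prod_min t
  let _ : MeasurableSpace Ω := ℱ t
  have h : Measurable fun p : ℝ × chamber n θ => G p.1 p.2 :=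
    measurable_from_prod_countable_left fun x => hG x
  have h2 : Measurable fun p : ℝ × Ω => G p.1 (X (min p.1.toNNReal t) p.2) :=
    h.comp (measurable_fst.prodMk hm)
  exact h2.stronglyMeasurable.integral_prod_left'

theorem IsWalk.integrable_comp [IsProbabilityMeasure P] (hX : IsWalk θ P ℱ X) (t : ℝ≥0)
    {E : Type*} [NormedAddCommGroup E] [MeasurableSpace E] [BorelSpace E]
    [SecondCountableTopology E]
    {f : (Fin n → ℝ) → E} {C : ℝ} (hf : ∀ x ∈ chamber n θ, ‖f x‖ ≤ C) :
    Integrable (fun ω => f (X t ω)) P :=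
  .of_bound (hX.measurable_comp t f).aestronglyMeasurable C (.of_forall fun ω => hf _ (X t ω).2)

theorem abs_generator_le (hθ : 0 < θ) {f : (Fin n → ℝ) → ℝ} {C : ℝ} (hf : ∀ x, |f x| ≤ C)
    {x : Fin n → ℝ} (hx : x ∈ chamber n θ) :
    |generator θ f x| ≤ n * ((θ * n * 2 ^ n) * (C + C)) := by
  have h := norm_complexGenerator_le hθ (f := fun y => (f y : ℂ)) (C := C)
    (fun y => by simpa using hf y) hx
  have h2 := complexGenerator_re (θ := θ) (fun y => (f y : ℂ)) x
  simp only [Complex.ofReal_re] at h2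
  rw [← h2]
  exact (Complex.abs_re_le_norm _).trans h

/-- On an event of ℱ r the Markov property replaces f(X_{r+h}) by the semigroup average started at
X_r, and the generator limit is uniform in the starting state. Hence δ depends neither on r nor on
A. -/
theorem IsWalk.real_increment [IsProbabilityMeasure P] (hX : IsWalk θ P ℱ X) (hθ : 0 < θ)
    {f : (Fin n → ℝ) → ℝ} {C : ℝ} (hf : ∀ x, |f x| ≤ C) {ε : ℝ} (hε : 0 < ε) :
    ∃ δ : ℝ≥0, 0 < δ ∧ ∀ r h : ℝ≥0, 0 < h → h < δ → ∀ A, MeasurableSet[ℱ r] A →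
      |∫ ω in A, (f (X (r + h) ω) - f (X r ω) - h * generator θ f (X r ω)) ∂P| ≤ ε * h := by
  obtain ⟨κ, hκ, hM⟩ := hX.markov
  have hb : ∃ C, ∀ x, |f x| ≤ C := ⟨C, hf⟩
  have hu := Metric.tendstoUniformly_iff.1 (hκ.generator_eq f hb) ε hε
  obtain ⟨δ, hδ, hδ'⟩ := (mem_nhdsGT_iff_exists_Ioo_subset' (show (0 : ℝ≥0) < 1 by simp)).1 hu
  refine ⟨δ, hδ, fun r h h0 hlt A hA => ?_⟩
  have hunif := hδ' ⟨h0, hlt⟩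
  have i1 := hX.integrable_comp (r + h) (f := f) fun x _ => hf x
  have i2 := hX.integrable_comp r (f := f) fun x _ => hf x
  have i3 := hX.integrable_comp r (f := generator θ f) fun x hx => abs_generator_le hθ hf hx
  have i4 : Integrable (fun ω => ∫ y, f y ∂(κ h (X r ω))) P :=
    (integrable_condExp (m := ℱ r)).congr (hM f hb r h)
  have key : ∫ ω in A, f (X (r + h) ω) ∂P = ∫ ω in A, (∫ y, f y ∂(κ h (X r ω))) ∂P := by
    rw [← setIntegral_condExp (ℱ.le r) i1 hA]
    exact integral_congr_ae (ae_restrict_of_ae (hM f hb r h))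
  have key2 : ∫ ω in A, (f (X (r + h) ω) - f (X r ω) - h * generator θ f (X r ω)) ∂P =
      ∫ ω in A, ((∫ y, f y ∂(κ h (X r ω))) - f (X r ω) - h * generator θ f (X r ω)) ∂P := by
    have hsub : ∀ {a b c : Ω → ℝ}, Integrable a P → Integrable b P → Integrable c P →
        ∫ ω in A, (a ω - b ω - c ω) ∂P =
          ∫ ω in A, a ω ∂P - ∫ ω in A, b ω ∂P - ∫ ω in A, c ω ∂P := by
      intro a b c ha hb hc
      rw [integral_sub (f := fun ω => a ω - b ω) (ha.sub hb).integrableOn hc.integrableOn,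
        integral_sub ha.integrableOn hb.integrableOn]
    rw [hsub i1 i2 (i3.const_mul _), hsub i4 i2 (i3.const_mul _), key]
  rw [key2, ← Real.norm_eq_abs]
  have h0' : (0 : ℝ) < h := h0
  refine (norm_setIntegral_le_of_norm_le_const (C := ε * h) (measure_lt_top P A) ?_).trans ?_
  · intro ω _
    have := hunif (X r ω)
    rw [dist_comm, Real.dist_eq] at this
    have h5 : (∫ y, f y ∂(κ h (X r ω))) - f (X r ω) - h * generator θ f (X r ω) =
        (((∫ y, f y ∂(κ h (X r ω))) - f (X r ω)) / h - generator θ f (X r ω)) * h := by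
      field_simp
    rw [h5, norm_mul, Real.norm_eq_abs, Real.norm_eq_abs, abs_of_pos h0']
    gcongr
  · exact mul_le_of_le_one_right (by positivity) measureReal_le_one

theorem IsWalk.increment [IsProbabilityMeasure P] (hX : IsWalk θ P ℱ X) (hθ : 0 < θ)
    {f : (Fin n → ℝ) → ℂ} {C : ℝ} (hf : ∀ x, ‖f x‖ ≤ C) {ε : ℝ} (hε : 0 < ε) :
    ∃ δ : ℝ≥0, 0 < δ ∧ ∀ r h : ℝ≥0, 0 < h → h < δ → ∀ A, MeasurableSet[ℱ r] A →
      ‖∫ ω in A, (f (X (r + h) ω) - f (X r ω) - h * complexGenerator θ f (X r ω)) ∂P‖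
        ≤ ε * h := by
  obtain ⟨δ₁, hδ₁, h₁⟩ := hX.real_increment hθ (f := fun x => (f x).re)
    (fun x => (Complex.abs_re_le_norm _).trans (hf x)) (half_pos hε)
  obtain ⟨δ₂, hδ₂, h₂⟩ := hX.real_increment hθ (f := fun x => (f x).im)
    (fun x => (Complex.abs_im_le_norm _).trans (hf x)) (half_pos hε)
  refine ⟨min δ₁ δ₂, lt_min hδ₁ hδ₂, fun r h h0 hlt A hA => ?_⟩
  have hint : Integrable
      (fun ω => f (X (r + h) ω) - f (X r ω) - h * complexGenerator θ f (X r ω)) P :=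
    ((hX.integrable_comp (r + h) fun x _ => hf x).sub
      (hX.integrable_comp r fun x _ => hf x)).sub
      ((hX.integrable_comp r fun x hx => norm_complexGenerator_le hθ hf hx).const_mul _)
  refine (Complex.norm_le_abs_re_add_abs_im _).trans ?_
  have e1 := Complex.reCLM.integral_comp_comm (hint.integrableOn (s := A))
  have e2 := Complex.imCLM.integral_comp_comm (hint.integrableOn (s := A))
  simp only [Complex.reCLM_apply, Complex.imCLM_apply] at e1 e2
  rw [← e1, ← e2]
  have b1 := h₁ r h h0 (hlt.trans_le (min_le_left _ _)) A hA
  have b2 := h₂ r h h0 (hlt.trans_le (min_le_right _ _)) A hA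
  simp only [Complex.sub_re, Complex.sub_im, Complex.mul_re, Complex.mul_im, complexGenerator_re,
    complexGenerator_im]
  simp only [show ((h : ℝ≥0) : ℂ).re = h from rfl, show ((h : ℝ≥0) : ℂ).im = 0 from rfl, zero_mul,
    sub_zero, add_zero]
  linarith

end Walk

/-! ### Dynkin's formula for time-dependent functions. -/

/-- A time-dependent test function: bounded, uniformly Lipschitz and right-differentiable in time. -/
structure IsTestFamily {n : ℕ} (C K : ℝ) (F : ℝ → (Fin n → ℝ) → ℂ) : Prop where
  norm_le : ∀ s x, ‖F s x‖ ≤ C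
  lipschitz : ∀ s r x, ‖F s x - F r x‖ ≤ K * |s - r|
  differentiable : ∀ s x, DifferentiableWithinAt ℝ (fun r => F r x) (Set.Ici s) s

/-- The right time derivative of a test function. -/
def timeDeriv {n : ℕ} (F : ℝ → (Fin n → ℝ) → ℂ) (s : ℝ) (x : Fin n → ℝ) : ℂ :=
  derivWithin (fun r => F r x) (Set.Ici s) s

namespace IsTestFamily

variable {n : ℕ} {θ C K : ℝ} {F : ℝ → (Fin n → ℝ) → ℂ}

theorem const_nonneg (hF : IsTestFamily C K F) : 0 ≤ K := by
  simpa using (norm_nonneg _).trans (hF.lipschitz 0 1 0)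

theorem continuous (hF : IsTestFamily C K F) (x : Fin n → ℝ) : Continuous fun s => F s x := by
  refine (LipschitzWith.of_dist_le_mul (K := ⟨K, hF.const_nonneg⟩) fun s r => ?_).continuous
  rw [dist_eq_norm, Real.dist_eq]
  exact hF.lipschitz s r x

theorem measurable_timeDeriv (x : Fin n → ℝ) : Measurable fun s => timeDeriv F s x :=
  measurable_derivWithin_Ici fun r => F r x

theorem measurable_generator (hF : IsTestFamily C K F) (x : Fin n → ℝ) :
    Measurable fun s => complexGenerator θ (F s) x :=
  (continuous_finsetSum _ fun _ _ =>
    continuous_const.mul ((hF.continuous _).sub (hF.continuous _))).measurable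

theorem tendsto_slope (hF : IsTestFamily C K F) (s : ℝ) (x : Fin n → ℝ) :
    Tendsto (slope (fun r => F r x) s) (𝓝[>] s) (𝓝 (timeDeriv F s x)) := by
  have h := (hF.differentiable s x).hasDerivWithinAt.mono Set.Ioi_subset_Ici_self
  rwa [hasDerivWithinAt_iff_tendsto_slope' (by simp : s ∉ Set.Ioi s)] at h

theorem norm_slope_le (hF : IsTestFamily C K F) (s r : ℝ) (x : Fin n → ℝ) :
    ‖slope (fun r => F r x) s r‖ ≤ K := by
  rw [slope_def_module, norm_smul, norm_inv, Real.norm_eq_abs]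
  rcases eq_or_ne r s with rfl | h
  · simpa using hF.const_nonneg
  · rw [inv_mul_le_iff₀ (abs_pos.2 (sub_ne_zero.2 h)), mul_comm]
    exact hF.lipschitz r s x

theorem norm_timeDeriv_le (hF : IsTestFamily C K F) (s : ℝ) (x : Fin n → ℝ) :
    ‖timeDeriv F s x‖ ≤ K :=
  le_of_tendsto (hF.tendsto_slope s x).norm (.of_forall fun r => hF.norm_slope_le s r x)

end IsTestFamily

section Dynkin

variable {Ω : Type*} {mΩ : MeasurableSpace Ω} {n : ℕ} {θ : ℝ} {P : Measure Ω}
  {ℱ : Filtration ℝ≥0 mΩ} {X : ℝ≥0 → Ω → chamber n θ} {C K : ℝ} {F : ℝ → (Fin n → ℝ) → ℂ}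

/-- The drift `∂ₛF + LF` of the process `F(s, Xₛ)`. -/
def dynkinDrift (θ : ℝ) (F : ℝ → (Fin n → ℝ) → ℂ) (s : ℝ) (x : Fin n → ℝ) : ℂ :=
  timeDeriv F s x + complexGenerator θ (F s) x

theorem IsTestFamily.measurable_dynkinDrift (hF : IsTestFamily C K F) (x : Fin n → ℝ) :
    Measurable fun s => dynkinDrift θ F s x :=
  (IsTestFamily.measurable_timeDeriv x).add (hF.measurable_generator x)

theorem IsTestFamily.norm_dynkinDrift_le (hF : IsTestFamily C K F) (hθ : 0 < θ) (s : ℝ)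
    (x : Fin n → ℝ) (hx : x ∈ chamber n θ) :
    ‖dynkinDrift θ F s x‖ ≤ K + n * ((θ * n * 2 ^ n) * (C + C)) :=
  (norm_add_le _ _).trans
    (add_le_add (hF.norm_timeDeriv_le s x) (norm_complexGenerator_le hθ (hF.norm_le s) hx))

theorem IsWalk.eventually_eq_right (hX : IsWalk θ P ℱ X) (ω : Ω) (r : ℝ) :
    ∀ᶠ r' in 𝓝[>] r, X r'.toNNReal ω = X r.toNNReal ω := by
  have h1 : ∀ᶠ u in 𝓝[≥] r.toNNReal, X u ω = X r.toNNReal ω := by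
    have := (hX.cadlag ω r.toNNReal).1
    rw [ContinuousWithinAt, nhds_discrete, tendsto_pure] at this
    exact this
  have h2 : Tendsto Real.toNNReal (𝓝[>] r) (𝓝[≥] r.toNNReal) :=
    tendsto_nhdsWithin_iff.2 ⟨continuous_real_toNNReal.continuousAt.mono_left nhdsWithin_le_nhds,
      eventually_mem_nhdsWithin.mono fun u hu => Real.toNNReal_le_toNNReal (le_of_lt hu)⟩
  exact h2.eventually h1

/-- The expectation of `f(Xᵣ)` on an event of the past moves by `O(h)` in time `h`. -/
theorem IsWalk.norm_setIntegral_sub_le [IsProbabilityMeasure P] (hX : IsWalk θ P ℱ X) (hθ : 0 < θ)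
    {f : (Fin n → ℝ) → ℂ} (hf : ∀ x, ‖f x‖ ≤ C) :
    ∃ δ : ℝ≥0, 0 < δ ∧ ∀ r h : ℝ≥0, 0 < h → h < δ → ∀ A, MeasurableSet[ℱ r] A →
      ‖∫ ω in A, f (X (r + h) ω) ∂P - ∫ ω in A, f (X r ω) ∂P‖
        ≤ (1 + n * ((θ * n * 2 ^ n) * (C + C))) * h := by
  obtain ⟨δ, hδ, H⟩ := hX.increment hθ hf one_pos
  refine ⟨δ, hδ, fun r h h0 hlt A hA => ?_⟩
  have i1 := (hX.integrable_comp (P := P) (r + h) fun x _ => hf x).integrableOn (s := A)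
  have i2 := (hX.integrable_comp (P := P) r fun x _ => hf x).integrableOn (s := A)
  have i3 := (hX.integrable_comp (P := P) r
    fun x hx => norm_complexGenerator_le hθ hf hx).integrableOn (s := A)
  have h1 := H r h h0 hlt A hA
  rw [integral_sub (f := fun ω => f (X (r + h) ω) - f (X r ω)) (i1.sub i2) (i3.const_mul _),
    integral_sub i1 i2, integral_const_mul] at h1
  have h2 : ‖(h : ℂ) * ∫ ω in A, complexGenerator θ f (X r ω) ∂P‖ ≤
      h * (n * ((θ * n * 2 ^ n) * (C + C))) := by
    have hB : 0 ≤ n * ((θ * n * 2 ^ n) * (C + C)) := by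
      have := (norm_nonneg _).trans (hf 0)
      positivity
    have hh : ‖(h : ℂ)‖ = h := by
      rw [show (h : ℂ) = ((h : ℝ) : ℂ) from rfl, Complex.norm_real]; simp
    rw [norm_mul, hh]
    gcongr
    exact (norm_setIntegral_le_of_norm_le_const (measure_lt_top P A)
      fun ω _ => norm_complexGenerator_le hθ hf (X r ω).2).trans
        (mul_le_of_le_one_right hB measureReal_le_one)
  have h3 := norm_le_norm_sub_add (∫ ω in A, f (X (r + h) ω) ∂P - ∫ ω in A, f (X r ω) ∂P)
    ((h : ℂ) * ∫ ω in A, complexGenerator θ f (X r ω) ∂P)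
  linarith

/-- Paths jump, but rarely: on events of the past, expectations move by O(h) when only the state
evolves, and the explicit time dependence is Lipschitz. The two estimates add up. -/
theorem IsWalk.continuousOn_setIntegral [IsProbabilityMeasure P] (hX : IsWalk θ P ℱ X)
    (hθ : 0 < θ) (hF : IsTestFamily C K F) {s : ℝ≥0} {A : Set Ω} (hA : MeasurableSet[ℱ s] A) :
    ContinuousOn (fun r : ℝ => ∫ ω in A, F r (X r.toNNReal ω) ∂P) (Set.Ici (s : ℝ)) := by
  intro r hr
  obtain ⟨δ, hδ, H⟩ := hX.norm_setIntegral_sub_le hθ (hF.norm_le r)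
  set B : ℝ := 1 + n * ((θ * n * 2 ^ n) * (C + C)) with hB
  have key : ∀ r' : ℝ, (s : ℝ) ≤ r' → |r' - r| < δ →
      ‖∫ ω in A, F r (X r'.toNNReal ω) ∂P - ∫ ω in A, F r (X r.toNNReal ω) ∂P‖ ≤ B * |r' - r| := by
    -- Since δ does not depend on the base time, the bound also covers increments ending at r, which
    -- gives left continuity.
    have main : ∀ u v : ℝ, (s : ℝ) ≤ u → u < v → v - u < δ →
        ‖∫ ω in A, F r (X v.toNNReal ω) ∂P - ∫ ω in A, F r (X u.toNNReal ω) ∂P‖ ≤ B * (v - u) := by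
      intro u v hu huv hδ'
      have h := H u.toNNReal (v - u).toNNReal (by simpa using huv)
        ((Real.toNNReal_lt_iff_lt_coe (by linarith)).2 hδ') A
        (ℱ.mono (NNReal.le_toNNReal_of_coe_le hu) _ hA)
      rw [← Real.toNNReal_add (s.coe_nonneg.trans hu) (by linarith), add_sub_cancel,
        Real.coe_toNNReal _ (by linarith)] at h
      exact h
    intro r' hr' hlt
    rcases lt_trichotomy r' r with h | h | h
    · rw [abs_sub_comm, abs_of_pos (sub_pos.2 h)] at hlt ⊢
      rw [norm_sub_rev]
      exact main r' r hr' h hlt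
    · simp [h]
    · rw [abs_of_pos (sub_pos.2 h)] at hlt ⊢
      exact main r r' hr h hlt
  have key2 : ∀ r' : ℝ,
      ‖∫ ω in A, F r' (X r'.toNNReal ω) ∂P - ∫ ω in A, F r (X r'.toNNReal ω) ∂P‖ ≤ K * |r' - r| := by
    intro r'
    rw [← integral_sub (hX.integrable_comp _ fun x _ => hF.norm_le _ x).integrableOn
      (hX.integrable_comp _ fun x _ => hF.norm_le _ x).integrableOn]
    have hK := hF.const_nonneg
    exact (norm_setIntegral_le_of_norm_le_const (measure_lt_top P A)
      fun ω _ => hF.lipschitz r' r _).trans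
        (mul_le_of_le_one_right (by positivity) measureReal_le_one)
  rw [ContinuousWithinAt, tendsto_iff_norm_sub_tendsto_zero]
  have hlim : Tendsto (fun r' : ℝ => (K + B) * |r' - r|) (𝓝[Set.Ici (s : ℝ)] r) (𝓝 0) := by
    have : Tendsto (fun r' : ℝ => (K + B) * |r' - r|) (𝓝 r) (𝓝 ((K + B) * |r - r|)) :=
      (continuous_const.mul (continuous_id.sub continuous_const).abs).tendsto r
    simpa using this.mono_left nhdsWithin_le_nhds
  refine squeeze_zero' (.of_forall fun _ => norm_nonneg _) ?_ hlim
  have hδr : ∀ᶠ r' in 𝓝[Set.Ici (s : ℝ)] r, |r' - r| < δ :=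
    nhdsWithin_le_nhds (Metric.ball_mem_nhds r (show (0 : ℝ) < δ from hδ))
  filter_upwards [hδr, eventually_mem_nhdsWithin] with r' h1 h2
  have := norm_sub_le_norm_sub_add_norm_sub (∫ ω in A, F r' (X r'.toNNReal ω) ∂P)
    (∫ ω in A, F r (X r'.toNNReal ω) ∂P) (∫ ω in A, F r (X r.toNNReal ω) ∂P)
  have h3 := key r' h2 h1
  have h4 := key2 r'
  linarith

/-- Split F(v, X_v) as [F(v, X_v) - F(r, X_v)] + F(r, X_v). For the first part, X_v = X_r when v is
close to r on the right and slopes are bounded by K, so dominated convergence yields the time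
derivative. The second part is the increment estimate for the fixed function F(r, ·). -/
theorem IsWalk.hasDerivWithinAt_setIntegral [IsProbabilityMeasure P] (hX : IsWalk θ P ℱ X)
    (hθ : 0 < θ) (hF : IsTestFamily C K F) {s : ℝ≥0} {A : Set Ω} (hA : MeasurableSet[ℱ s] A)
    {r : ℝ} (hr : s ≤ r) :
    HasDerivWithinAt (fun r : ℝ => ∫ ω in A, F r (X r.toNNReal ω) ∂P)
      (∫ ω in A, dynkinDrift θ F r (X r.toNNReal ω) ∂P) (Set.Ioi r) r := by
  have hr0 : 0 ≤ r := s.coe_nonneg.trans hr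
  have iF : ∀ a b : ℝ, IntegrableOn (fun ω => F a (X b.toNNReal ω)) A P := fun a b =>
    (hX.integrable_comp _ fun x _ => hF.norm_le _ x).integrableOn
  have iG : IntegrableOn (fun ω => complexGenerator θ (F r) (X r.toNNReal ω)) A P :=
    (hX.integrable_comp _ fun x hx => norm_complexGenerator_le hθ (hF.norm_le r) hx).integrableOn
  have iT : IntegrableOn (fun ω => timeDeriv F r (X r.toNNReal ω)) A P :=
    (hX.integrable_comp _ fun x _ => hF.norm_timeDeriv_le r x).integrableOn
  have h1 : HasDerivWithinAt
      (fun r' : ℝ => ∫ ω in A, (F r' (X r'.toNNReal ω) - F r (X r'.toNNReal ω)) ∂P)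
      (∫ ω in A, timeDeriv F r (X r.toNNReal ω) ∂P) (Set.Ioi r) r := by
    rw [hasDerivWithinAt_iff_tendsto_slope' (by simp : r ∉ Set.Ioi r)]
    have heq : slope (fun r' : ℝ => ∫ ω in A, (F r' (X r'.toNNReal ω) - F r (X r'.toNNReal ω)) ∂P) r
        = fun r' => ∫ ω in A, slope (fun u => F u (X r'.toNNReal ω)) r r' ∂P := by
      funext r'
      simp only [slope_def_module, sub_self, integral_zero, sub_zero]
      rw [integral_smul]
    rw [heq]
    refine tendsto_integral_filter_of_dominated_convergence (fun _ => K) ?_ ?_ ?_ ?_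
    · refine .of_forall fun r' => ?_
      exact (hX.measurable_comp r'.toNNReal
        (fun x => slope (fun u => F u x) r r')).aestronglyMeasurable
    · exact .of_forall fun r' => .of_forall fun ω => hF.norm_slope_le r r' _
    · exact integrable_const _
    · refine .of_forall fun ω => ?_
      refine (hF.tendsto_slope r (X r.toNNReal ω)).congr' ?_
      filter_upwards [hX.eventually_eq_right ω r] with r' hr'
      rw [hr']
  have h2 : HasDerivWithinAt (fun r' : ℝ => ∫ ω in A, F r (X r'.toNNReal ω) ∂P)
      (∫ ω in A, complexGenerator θ (F r) (X r.toNNReal ω) ∂P) (Set.Ioi r) r := by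
    rw [hasDerivWithinAt_iff_isLittleO, Asymptotics.isLittleO_iff]
    intro ε hε
    obtain ⟨δ, hδ, H⟩ := hX.increment hθ (hF.norm_le r) hε
    have hδ' : (0 : ℝ) < δ := hδ
    filter_upwards [Ioo_mem_nhdsGT (lt_add_of_pos_right r hδ')] with v hv
    have hv0 : r < v := hv.1
    have h := H r.toNNReal (v - r).toNNReal (by simpa using hv.1)
        ((Real.toNNReal_lt_iff_lt_coe (by linarith)).2 (by linarith [hv.2])) A
        (ℱ.mono (NNReal.le_toNNReal_of_coe_le hr) _ hA)
    have hc : (((v - r).toNNReal : ℝ≥0) : ℂ) = ((v - r : ℝ) : ℂ) := by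
      rw [show (((v - r).toNNReal : ℝ≥0) : ℂ) = (((v - r).toNNReal : ℝ) : ℂ) from rfl,
        Real.coe_toNNReal _ (by linarith)]
    rw [← Real.toNNReal_add hr0 (by linarith), add_sub_cancel, hc,
      Real.coe_toNNReal _ (by linarith), integral_sub
      (f := fun ω => F r (X v.toNNReal ω) - F r (X r.toNNReal ω)) ((iF r v).sub (iF r r))
      (iG.const_mul _), integral_sub (iF r v) (iF r r), integral_const_mul] at h
    rw [Complex.real_smul, Real.norm_eq_abs, abs_of_pos (by linarith : 0 < v - r)]
    exact h
  have h3 := h1.add h2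
  rw [← integral_add iT iG] at h3
  refine h3.congr_of_eventuallyEq (.of_forall fun v => ?_) ?_
  · simp only [Pi.add_apply]
    rw [integral_sub (iF v v) (iF r v)]
    ring
  · simp

theorem IsWalk.integrable_prod_dynkinDrift [IsProbabilityMeasure P] (hX : IsWalk θ P ℱ X)
    (hθ : 0 < θ) (hF : IsTestFamily C K F) (a b : ℝ) (A : Set Ω) :
    Integrable (fun p : ℝ × Ω => dynkinDrift θ F p.1 (X p.1.toNNReal p.2))
      ((volume.restrict (Set.Ioc a b)).prod (P.restrict A)) :=
  .of_bound (hX.measurable_field fun x => hF.measurable_dynkinDrift x).aestronglyMeasurable _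
    (.of_forall fun p => hF.norm_dynkinDrift_le hθ p.1 _ (X _ p.2).2)

/-- Dynkin's formula on an event of the past. -/
theorem IsWalk.setIntegral_dynkin [IsProbabilityMeasure P] (hX : IsWalk θ P ℱ X)
    (hθ : 0 < θ) (hF : IsTestFamily C K F) {s t : ℝ≥0} (hst : s ≤ t) {A : Set Ω}
    (hA : MeasurableSet[ℱ s] A) :
    ∫ ω in A, (∫ r in (s : ℝ)..t, dynkinDrift θ F r (X r.toNNReal ω)) ∂P =
      ∫ ω in A, F t (X t ω) ∂P - ∫ ω in A, F s (X s ω) ∂P := by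
  have hst' : (s : ℝ) ≤ t := hst
  have hint := hX.integrable_prod_dynkinDrift (P := P) hθ hF s t A
  -- Continuity together with a right derivative is enough for this form of the fundamental theorem;
  -- Fubini then moves the time integral inside the expectation.
  have h := intervalIntegral.integral_eq_sub_of_hasDeriv_right_of_le hst'
    ((hX.continuousOn_setIntegral hθ hF hA).mono Set.Icc_subset_Ici_self)
    (fun r hr => hX.hasDerivWithinAt_setIntegral hθ hF hA hr.1.le)
    ((intervalIntegrable_iff_integrableOn_Ioc_of_le hst').2 hint.integral_prod_left)
  simp only [Real.toNNReal_coe] at h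
  rw [← h, intervalIntegral.integral_of_le hst', integral_integral_swap hint]
  simp only [intervalIntegral.integral_of_le hst']

/-- The martingale in Dynkin's formula. -/
def dynkinMartingale (θ : ℝ) (X : ℝ≥0 → Ω → chamber n θ) (F : ℝ → (Fin n → ℝ) → ℂ) (t : ℝ≥0)
    (ω : Ω) : ℂ :=
  F t (X t ω) - F 0 (X 0 ω) - ∫ r in (0 : ℝ)..t, dynkinDrift θ F r (X r.toNNReal ω)

theorem IsWalk.stronglyMeasurable_dynkinMartingale (hX : IsWalk θ P ℱ X)
    (hF : IsTestFamily C K F) (t : ℝ≥0) :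
    StronglyMeasurable[ℱ t] (dynkinMartingale θ X F t) := by
  have h : ∀ (u : ℝ≥0) (f : (Fin n → ℝ) → ℂ), StronglyMeasurable[ℱ u] fun ω => f (X u ω) :=
    fun u f => ((Measurable.of_discrete (f := fun x : chamber n θ => f x)).comp
      (hX.measurable_adapted u)).stronglyMeasurable
  exact ((h t (F t)).sub ((h 0 (F 0)).mono (ℱ.mono zero_le))).sub
    (hX.stronglyMeasurable_integral hF.measurable_dynkinDrift t)

theorem IsWalk.integrable_dynkinMartingale [IsProbabilityMeasure P] (hX : IsWalk θ P ℱ X)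
    (hθ : 0 < θ) (hF : IsTestFamily C K F) (t : ℝ≥0) :
    Integrable (dynkinMartingale θ X F t) P := by
  refine ((hX.integrable_comp t fun x _ => hF.norm_le t x).sub
    (hX.integrable_comp 0 fun x _ => hF.norm_le 0 x)).sub ?_
  have := (hX.integrable_prod_dynkinDrift (P := P) hθ hF 0 t Set.univ).integral_prod_right
  rw [Measure.restrict_univ] at this
  simpa only [intervalIntegral.integral_of_le t.coe_nonneg] using this

/-- The increment from s to t integrates to zero over every event of ℱ s, by Dynkin's formula on
that event. -/
theorem IsWalk.martingale_dynkin [IsProbabilityMeasure P] (hX : IsWalk θ P ℱ X)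
    (hθ : 0 < θ) (hF : IsTestFamily C K F) : Martingale (dynkinMartingale θ X F) ℱ P := by
  refine ⟨fun t => hX.stronglyMeasurable_dynkinMartingale hF t, fun s t hst => ?_⟩
  refine (ae_eq_condExp_of_forall_setIntegral_eq (ℱ.le s)
    (hX.integrable_dynkinMartingale hθ hF t)
    (fun A _ _ => (hX.integrable_dynkinMartingale hθ hF s).integrableOn) (fun A hA _ => ?_)
    (hX.stronglyMeasurable_dynkinMartingale hF s).aestronglyMeasurable).symm
  have hI : ∀ a b : ℝ, Integrable
      (fun ω => ∫ r in a..b, dynkinDrift θ F r (X r.toNNReal ω)) (P.restrict A) := fun a b =>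
    ((hX.integrable_prod_dynkinDrift (P := P) hθ hF a b A).integral_prod_right.sub
      (hX.integrable_prod_dynkinDrift (P := P) hθ hF b a A).integral_prod_right)
  have hdiff : ∀ ω, dynkinMartingale θ X F t ω - dynkinMartingale θ X F s ω =
      (F t (X t ω) - F s (X s ω)) - ∫ r in (s : ℝ)..t, dynkinDrift θ F r (X r.toNNReal ω) := by
    intro ω
    have hi := hX.intervalIntegrable (fun x => hF.measurable_dynkinDrift x)
      (fun s x hx => hF.norm_dynkinDrift_le hθ s x hx) ω
    rw [dynkinMartingale, dynkinMartingale,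
      ← intervalIntegral.integral_add_adjacent_intervals (hi 0 s) (hi s t)]
    ring
  have hint := fun u => (hX.integrable_dynkinMartingale (P := P) hθ hF u).integrableOn (s := A)
  have iF : ∀ u : ℝ≥0, IntegrableOn (fun ω => F u (X u ω)) A P := fun u =>
    (hX.integrable_comp _ fun x _ => hF.norm_le _ x).integrableOn
  rw [eq_comm, ← sub_eq_zero, ← integral_sub (hint t) (hint s)]
  simp only [hdiff]
  rw [integral_sub (f := fun ω => F t (X t ω) - F s (X s ω)) ((iF t).sub (iF s)) (hI s t),
    integral_sub (iF t) (iF s), hX.setIntegral_dynkin hθ hF hst hA, sub_self]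

theorem martingale_stopped [IsProbabilityMeasure P] {M : ℝ≥0 → Ω → ℂ} (hM : Martingale M ℱ P)
    (T : ℝ≥0) : Martingale (fun t => M (min t T)) ℱ P := by
  refine ⟨fun t => (hM.1 (min t T)).mono (ℱ.mono (min_le_left t T)), fun s t hst => ?_⟩
  change P[M (min t T) | ℱ s] =ᵐ[P] M (min s T)
  rcases le_total s T with h | h
  · rw [min_eq_left h]
    exact hM.2 s (min t T) (le_min hst h)
  · rw [min_eq_right h, min_eq_right (h.trans hst),
      condExp_of_stronglyMeasurable (ℱ.le s) ((hM.1 T).mono (ℱ.mono h)) (hM.integrable T)]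

end Dynkin

/-! ### Jumps of càdlàg paths in a discrete space. -/

section Jumps

variable {E : Type*} {x : ℝ≥0 → E}

/-- The discontinuity times of a path in a discrete space. -/
def jumpTimes (x : ℝ≥0 → E) : Set ℝ≥0 := {s | ¬ ∀ᶠ u in 𝓝[<] s, x u = x s}

theorem pos_of_mem_jumpTimes {s : ℝ≥0} (hs : s ∈ jumpTimes x) : 0 < s := by
  rw [pos_iff_ne_zero]
  rintro rfl
  refine hs ?_
  simp

/-- The jump of `g ∘ x` at time `s`. -/
def jumpAt (g : E → ℂ) (x : ℝ≥0 → E) (s : ℝ≥0) : ℂ := g (x s) - Function.leftLim (fun u => g (x u)) s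

theorem jumpAt_of_eventually (g : E → ℂ) {s : ℝ≥0} (hs : 0 < s) {l : E}
    (hl : ∀ᶠ u in 𝓝[<] s, x u = l) : jumpAt g x s = g (x s) - g l := by
  have : (𝓝[<] s).NeBot := nhdsLT_neBot_of_exists_lt ⟨0, hs⟩
  rw [jumpAt, leftLim_eq_of_tendsto (y := g l)]
  exact tendsto_const_nhds.congr' (hl.mono fun u hu => by simp only [hu])

theorem jumpAt_of_notMem (g : E → ℂ) {s : ℝ≥0} (hs : s ∉ jumpTimes x) : jumpAt g x s = 0 := by
  rcases eq_zero_or_pos s with rfl | h0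
  · rw [jumpAt, leftLim_eq_of_isBot (fun _ => zero_le), sub_self]
  · rw [jumpAt_of_eventually g h0 (not_not.1 hs), sub_self]

end Jumps

section Path

variable {E : Type*} [TopologicalSpace E] [DiscreteTopology E] {x : ℝ≥0 → E}

theorem IsCadlag.eventually_right (hx : IsCadlag x) (t : ℝ≥0) : ∀ᶠ u in 𝓝[≥] t, x u = x t := by
  have := (hx t).1
  rwa [ContinuousWithinAt, nhds_discrete, tendsto_pure] at this

theorem IsCadlag.exists_eventually_left (hx : IsCadlag x) (t : ℝ≥0) :
    ∃ l, ∀ᶠ u in 𝓝[<] t, x u = l := by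
  obtain ⟨l, hl⟩ := (hx t).2
  rw [nhds_discrete, tendsto_pure] at hl
  exact ⟨l, hl⟩

/-- In a discrete space a càdlàg path is constant on a punctured one-sided neighbourhood on each
side of every t, so t has a neighbourhood whose only possible jump time is t itself. Compactness of
[0, T] does the rest. -/
theorem IsCadlag.finite_jumpTimes (hx : IsCadlag x) (T : ℝ≥0) :
    (jumpTimes x ∩ Set.Icc 0 T).Finite := by
  rw [Set.inter_comm]
  have hc : IsCompact (Set.Icc 0 T) := isCompact_Icc
  have h : ∀ t ∈ Set.Icc 0 T, ∃ U ∈ 𝓝[Set.Icc 0 T] t, (U ∩ jumpTimes x).Finite := by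
    intro t _
    obtain ⟨l, hl⟩ := hx.exists_eventually_left t
    have hr := hx.eventually_right t
    have h1 : ∀ᶠ s in 𝓝[<] t, s ∉ jumpTimes x := by
      have hl' := (eventually_eventually_nhdsWithin (s := Set.Iio t)).2 hl
      filter_upwards [hl', hl, eventually_mem_nhdsWithin] with s h1 h2 hs
      refine not_not.2 ?_
      rw [(IsOpen.nhdsWithin_eq isOpen_Iio hs)] at h1
      exact (h1.filter_mono nhdsWithin_le_nhds).mono fun u hu => hu.trans h2.symm
    have h2 : ∀ᶠ s in 𝓝[>] t, s ∉ jumpTimes x := by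
      have hr0 : ∀ᶠ u in 𝓝[>] t, x u = x t := hr.filter_mono (nhdsWithin_mono _ Set.Ioi_subset_Ici_self)
      have hr' := (eventually_eventually_nhdsWithin (s := Set.Ioi t)).2 hr0
      filter_upwards [hr', hr0, eventually_mem_nhdsWithin] with s h1 h2 hs
      refine not_not.2 ?_
      rw [(IsOpen.nhdsWithin_eq isOpen_Ioi hs)] at h1
      exact (h1.filter_mono nhdsWithin_le_nhds).mono fun u hu => hu.trans h2.symm
    have h3 : ∀ᶠ s in 𝓝[≠] t, s ∉ jumpTimes x := by
      rw [← Set.Iio_union_Ioi, nhdsWithin_union]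
      exact eventually_sup.2 ⟨h1, h2⟩
    refine ⟨{s | s ≠ t → s ∉ jumpTimes x}, nhdsWithin_le_nhds (eventually_nhdsWithin_iff.1 h3), ?_⟩
    refine (Set.finite_singleton t).subset ?_
    rintro s ⟨h4, h5⟩
    by_contra hne
    exact h4 hne h5
  refine hc.induction_on (p := fun S => (S ∩ jumpTimes x).Finite) (by simp)
    (fun s t hst ht => ht.subset (Set.inter_subset_inter_left _ hst))
    (fun s t hs ht => by rw [Set.union_inter_distrib_right]; exact hs.union ht) h

/-- A time-dependent function along a path with finitely many jumps is the sum of the integral of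
its right time derivative and of its jumps. -/
theorem IsCadlag.sub_eq_integral_add_sum_jumps (hx : IsCadlag x) {T : ℝ≥0} {J : Finset ℝ≥0}
    (hJ : ∀ s, s ∈ J ↔ s ∈ jumpTimes x ∩ Set.Icc 0 T) {F F' : ℝ → E → ℂ}
    (hF : ∀ y, Continuous fun s => F s y)
    (hF' : ∀ s y, HasDerivWithinAt (fun s => F s y) (F' s y) (Set.Ioi s) s)
    (hi : ∀ a b, IntervalIntegrable (fun s => F' s (x s.toNNReal)) volume a b)
    {t : ℝ≥0} (ht : t ≤ T) :
    F t (x t) - F 0 (x 0) - ∫ s in (0 : ℝ)..t, F' s (x s.toNNReal) =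
      ∑ τ ∈ J, if τ ≤ t then jumpAt (F τ) x τ else 0 := by
  -- Removing the jumps that have occurred by time r leaves a path that is continuous up to T and
  -- has right derivative F', to which the fundamental theorem applies. The bound r ≤ T matters for
  -- left continuity, because J lists jumps only up to T.
  set ψ : ℝ → ℂ := fun r => F r (x r.toNNReal) -
    ∑ τ ∈ J, if (τ : ℝ) ≤ r then jumpAt (F τ) x τ else 0 with hψ
  have hJpos : ∀ τ ∈ J, (0 : ℝ) < τ := fun τ hτ => pos_of_mem_jumpTimes ((hJ τ).1 hτ).1
  have right : ∀ r, ∀ᶠ u in 𝓝[>] r, ψ u = F u (x r.toNNReal) -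
      ∑ τ ∈ J, if (τ : ℝ) ≤ r then jumpAt (F τ) x τ else 0 := by
    intro r
    have h2 : Tendsto Real.toNNReal (𝓝[>] r) (𝓝[≥] r.toNNReal) :=
      tendsto_nhdsWithin_iff.2 ⟨continuous_real_toNNReal.continuousAt.mono_left nhdsWithin_le_nhds,
        eventually_mem_nhdsWithin.mono fun u hu => Real.toNNReal_le_toNNReal (le_of_lt hu)⟩
    have h3 : ∀ᶠ u in 𝓝[>] r, ∀ τ ∈ J, ((τ : ℝ) ≤ u ↔ (τ : ℝ) ≤ r) := by
      rw [Filter.eventually_all_finset]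
      intro τ _
      rcases le_or_gt (τ : ℝ) r with h | h
      · filter_upwards [eventually_mem_nhdsWithin] with u hu
        exact ⟨fun _ => h, fun _ => h.trans (le_of_lt hu)⟩
      · filter_upwards [nhdsWithin_le_nhds (Iio_mem_nhds h)] with u hu
        exact ⟨fun h' => absurd hu (not_lt.2 h'), fun h' => absurd h (not_lt.2 h')⟩
    filter_upwards [h2.eventually (hx.eventually_right _), h3] with u h4 h5
    rw [hψ]
    simp only [h4]
    congr 1
    exact Finset.sum_congr rfl fun τ hτ => by simp only [h5 τ hτ]
  have left : ∀ r ≤ (T : ℝ), Tendsto ψ (𝓝[<] r) (𝓝 (ψ r)) := by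
    intro r hrT
    obtain ⟨l, hl, hlr⟩ : ∃ l, (∀ᶠ u : ℝ in 𝓝[<] r, x u.toNNReal = l) ∧
        F r (x r.toNNReal) - F r l = ∑ τ ∈ J, if (τ : ℝ) = r then jumpAt (F τ) x τ else 0 := by
      rcases le_or_gt r 0 with h0 | h0
      · refine ⟨x 0, ?_, ?_⟩
        · filter_upwards [eventually_mem_nhdsWithin] with u hu
          rw [Real.toNNReal_of_nonpos ((le_of_lt hu).trans h0)]
        · rw [Real.toNNReal_of_nonpos h0, sub_self, eq_comm]
          refine Finset.sum_eq_zero fun τ hτ => if_neg ?_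
          have := hJpos τ hτ
          linarith
      · obtain ⟨l, hl⟩ := hx.exists_eventually_left r.toNNReal
        refine ⟨l, ?_, ?_⟩
        · have h2 : Tendsto Real.toNNReal (𝓝[<] r) (𝓝[<] r.toNNReal) :=
            tendsto_nhdsWithin_iff.2
              ⟨continuous_real_toNNReal.continuousAt.mono_left nhdsWithin_le_nhds,
              eventually_mem_nhdsWithin.mono fun u hu =>
                (Real.toNNReal_lt_toNNReal_iff h0).2 hu⟩
          exact h2.eventually hl
        · have hr0 : 0 < r.toNNReal := Real.toNNReal_pos.2 h0
          have hj : jumpAt (F r) x r.toNNReal = F r (x r.toNNReal) - F r l :=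
            jumpAt_of_eventually _ hr0 hl
          rw [← hj]
          have hiff : ∀ τ : ℝ≥0, (τ : ℝ) = r ↔ τ = r.toNNReal := fun τ =>
            ⟨fun h => by rw [← h, Real.toNNReal_coe], fun h => by rw [h, Real.coe_toNNReal _ h0.le]⟩
          simp only [hiff]
          rw [Finset.sum_ite_eq']
          split_ifs with hm
          · rw [Real.coe_toNNReal _ h0.le]
          · refine jumpAt_of_notMem _ fun hm' => hm ((hJ _).2 ⟨hm', zero_le, ?_⟩)
            exact Real.toNNReal_le_iff_le_coe.2 hrT
    have h3 : ∀ᶠ u in 𝓝[<] r, ∀ τ ∈ J, ((τ : ℝ) ≤ u ↔ (τ : ℝ) < r) := by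
      rw [Filter.eventually_all_finset]
      intro τ _
      rcases lt_or_ge (τ : ℝ) r with h | h
      · filter_upwards [nhdsWithin_le_nhds (Ioi_mem_nhds h)] with u hu
        exact ⟨fun _ => h, fun _ => le_of_lt hu⟩
      · filter_upwards [eventually_mem_nhdsWithin] with u hu
        exact ⟨fun h' => absurd (h.trans h') (not_le.2 hu), fun h' => absurd h' (not_lt.2 h)⟩
    have h6 : ψ r = F r l - ∑ τ ∈ J, if (τ : ℝ) < r then jumpAt (F τ) x τ else 0 := by
      have h7 : ∑ τ ∈ J, (if (τ : ℝ) ≤ r then jumpAt (F τ) x τ else 0) =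
          (∑ τ ∈ J, if (τ : ℝ) < r then jumpAt (F τ) x τ else 0) +
            ∑ τ ∈ J, if (τ : ℝ) = r then jumpAt (F τ) x τ else 0 := by
        rw [← Finset.sum_add_distrib]
        refine Finset.sum_congr rfl fun τ _ => ?_
        rcases lt_trichotomy (τ : ℝ) r with h | h | h
        · simp [h, h.le, h.ne]
        · simp [h]
        · simp [h.not_ge, h.ne', h.not_gt]
      simp only [hψ]
      rw [h7, ← hlr]
      ring
    rw [h6]
    have h8 : Tendsto (fun u => F u l - ∑ τ ∈ J, if (τ : ℝ) < r then jumpAt (F τ) x τ else 0)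
        (𝓝[<] r) (𝓝 (F r l - ∑ τ ∈ J, if (τ : ℝ) < r then jumpAt (F τ) x τ else 0)) :=
      (((hF l).tendsto r).mono_left nhdsWithin_le_nhds).sub_const _
    refine h8.congr' ?_
    filter_upwards [hl, h3] with u h4 h5
    rw [hψ]
    simp only [h4]
    congr 1
    exact Finset.sum_congr rfl fun τ hτ => by simp only [h5 τ hτ]
  have hderiv : ∀ r, HasDerivWithinAt ψ (F' r (x r.toNNReal)) (Set.Ioi r) r := fun r =>
    ((hF' r (x r.toNNReal)).sub_const _).congr_of_eventuallyEq (right r) rfl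
  have hcont : ∀ r ≤ (T : ℝ), ContinuousAt ψ r := fun r hr =>
    continuousAt_iff_continuous_left'_right'.2 ⟨left r hr, (hderiv r).continuousWithinAt⟩
  have h := intervalIntegral.integral_eq_sub_of_hasDeriv_right_of_le (f := ψ) t.coe_nonneg
    (fun r hr => (hcont r (hr.2.trans ht)).continuousWithinAt) (fun r _ => hderiv r) (hi 0 t)
  have h0 : ψ 0 = F 0 (x 0) := by
    simp only [hψ, Real.toNNReal_zero]
    rw [Finset.sum_eq_zero, sub_zero]
    exact fun τ hτ => if_neg (not_le.2 (hJpos τ hτ))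
  rw [h, h0]
  simp only [hψ, Real.toNNReal_coe, NNReal.coe_le_coe]
  ring

end Path

/-! ### Pathwise quadratic covariation. -/

/-- The sum of products of increments of `a` and `b` along a partition, up to time `t`. -/
def incrementSum (L : ℕ) (π : ℕ → ℝ≥0) (a b : ℝ≥0 → ℂ) (t : ℝ≥0) : ℂ :=
  ∑ i ∈ Finset.range L,
    (a (min (π (i + 1)) t) - a (min (π i) t)) * (b (min (π (i + 1)) t) - b (min (π i) t))

/-- Deterministic quadratic covariation of two paths, uniformly on `[0, T]`. -/
def HasCovariation (T : ℝ≥0) (a b V : ℝ≥0 → ℂ) : Prop :=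
  ∀ ε : ℝ, 0 < ε → ∃ δ : ℝ≥0, 0 < δ ∧ ∀ (L : ℕ) (π : ℕ → ℝ≥0), Monotone π → π 0 = 0 → π L = T →
    (∀ i < L, π (i + 1) ≤ π i + δ) → ∀ t ≤ T, ‖incrementSum L π a b t - V t‖ ≤ ε

namespace HasCovariation

variable {T : ℝ≥0} {a a' b b' V V' : ℝ≥0 → ℂ}

theorem symm (h : HasCovariation T a b V) : HasCovariation T b a V := by
  intro ε hε
  obtain ⟨δ, hδ, H⟩ := h ε hε
  refine ⟨δ, hδ, fun L π h1 h2 h3 h4 t ht => ?_⟩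
  have : incrementSum L π b a t = incrementSum L π a b t :=
    Finset.sum_congr rfl fun i _ => mul_comm _ _
  rw [this]
  exact H L π h1 h2 h3 h4 t ht

theorem add_left (h : HasCovariation T a b V) (h' : HasCovariation T a' b V') :
    HasCovariation T (fun t => a t + a' t) b (fun t => V t + V' t) := by
  intro ε hε
  obtain ⟨δ, hδ, H⟩ := h (ε / 2) (half_pos hε)
  obtain ⟨δ', hδ', H'⟩ := h' (ε / 2) (half_pos hε)
  refine ⟨min δ δ', lt_min hδ hδ', fun L π h1 h2 h3 h4 t ht => ?_⟩
  have e : incrementSum L π (fun t => a t + a' t) b t =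
      incrementSum L π a b t + incrementSum L π a' b t := by
    rw [incrementSum, incrementSum, incrementSum, ← Finset.sum_add_distrib]
    exact Finset.sum_congr rfl fun i _ => by ring
  rw [e, add_sub_add_comm]
  have h5 := H L π h1 h2 h3 (fun i hi => (h4 i hi).trans (by gcongr; exact min_le_left _ _)) t ht
  have h6 := H' L π h1 h2 h3 (fun i hi => (h4 i hi).trans (by gcongr; exact min_le_right _ _)) t ht
  exact (norm_add_le _ _).trans (by linarith)

theorem add_right (h : HasCovariation T a b V) (h' : HasCovariation T a b' V') :
    HasCovariation T a (fun t => b t + b' t) (fun t => V t + V' t) :=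
  (h.symm.add_left h'.symm).symm

theorem const_mul_left (h : HasCovariation T a b V) (c : ℂ) :
    HasCovariation T (fun t => c * a t) b (fun t => c * V t) := by
  intro ε hε
  obtain ⟨δ, hδ, H⟩ := h (ε / (‖c‖ + 1)) (by positivity)
  refine ⟨δ, hδ, fun L π h1 h2 h3 h4 t ht => ?_⟩
  have e : incrementSum L π (fun t => c * a t) b t = c * incrementSum L π a b t := by
    rw [incrementSum, incrementSum, Finset.mul_sum]
    exact Finset.sum_congr rfl fun i _ => by ring
  rw [e, ← mul_sub, norm_mul]
  calc ‖c‖ * ‖incrementSum L π a b t - V t‖ ≤ (‖c‖ + 1) * (ε / (‖c‖ + 1)) :=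
        mul_le_mul (by linarith) (H L π h1 h2 h3 h4 t ht) (norm_nonneg _) (by positivity)
    _ = ε := by field_simp

theorem const_mul_right (h : HasCovariation T a b V) (c : ℂ) :
    HasCovariation T a (fun t => c * b t) (fun t => c * V t) :=
  (h.symm.const_mul_left c).symm

theorem zero_left (T : ℝ≥0) (b : ℝ≥0 → ℂ) : HasCovariation T (fun _ => 0) b (fun _ => 0) := by
  intro ε hε
  refine ⟨1, one_pos, fun L π _ _ _ _ t _ => ?_⟩
  simpa [incrementSum] using hε.le

theorem sum_left {ι : Type*} {J : Finset ι} {a V : ι → ℝ≥0 → ℂ}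
    (h : ∀ i ∈ J, HasCovariation T (a i) b (V i)) :
    HasCovariation T (fun t => ∑ i ∈ J, a i t) b (fun t => ∑ i ∈ J, V i t) := by
  classical
  induction J using Finset.induction_on with
  | empty => simpa using zero_left T b
  | insert i J hi ih =>
    simp only [Finset.sum_insert hi]
    exact (h i (Finset.mem_insert_self i J)).add_left
      (ih fun j hj => h j (Finset.mem_insert_of_mem hj))

theorem sum_right {ι : Type*} {J : Finset ι} {b V : ι → ℝ≥0 → ℂ}
    (h : ∀ i ∈ J, HasCovariation T a (b i) (V i)) :
    HasCovariation T a (fun t => ∑ i ∈ J, b i t) (fun t => ∑ i ∈ J, V i t) :=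
  (sum_left fun i hi => (h i hi).symm).symm

theorem congr (h : HasCovariation T a b V) (ha : ∀ t ≤ T, a' t = a t) (hb : ∀ t ≤ T, b' t = b t)
    (hV : ∀ t ≤ T, V' t = V t) : HasCovariation T a' b' V' := by
  intro ε hε
  obtain ⟨δ, hδ, H⟩ := h ε hε
  refine ⟨δ, hδ, fun L π h1 h2 h3 h4 t ht => ?_⟩
  have e : incrementSum L π a' b' t = incrementSum L π a b t := by
    refine Finset.sum_congr rfl fun i _ => ?_
    have hm : ∀ p, min p t ≤ T := fun p => (min_le_right _ _).trans ht
    rw [ha _ (hm _), ha _ (hm _), hb _ (hm _), hb _ (hm _)]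
  rw [e, hV t ht]
  exact H L π h1 h2 h3 h4 t ht

/-- A Lipschitz path has no covariation with a path of bounded variation. -/
theorem of_lipschitz {K B : ℝ} (hK : 0 ≤ K) (hB : 0 ≤ B)
    (ha : ∀ s t : ℝ≥0, s ≤ t → ‖a t - a s‖ ≤ K * ((t : ℝ) - s))
    (hb : ∀ (L : ℕ) (π : ℕ → ℝ≥0), Monotone π → π 0 = 0 → π L = T → ∀ t ≤ T,
      ∑ i ∈ Finset.range L, ‖b (min (π (i + 1)) t) - b (min (π i) t)‖ ≤ B) :
    HasCovariation T a b fun _ => 0 := by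
  intro ε hε
  -- Each increment of a is at most K δ, so the sum is at most K δ B; the added ones keep the
  -- denominator positive when K or B vanishes.
  refine ⟨⟨ε / ((K + 1) * (B + 1)), by positivity⟩, ?_, fun L π h1 h2 h3 h4 t ht => ?_⟩
  · exact NNReal.coe_pos.1 (show 0 < ε / ((K + 1) * (B + 1)) by positivity)
  set δ : ℝ := ε / ((K + 1) * (B + 1)) with hδ
  have hδ0 : 0 < δ := by positivity
  rw [sub_zero]
  refine (norm_sum_le _ _).trans ?_
  calc ∑ i ∈ Finset.range L, ‖(a (min (π (i + 1)) t) - a (min (π i) t)) *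
        (b (min (π (i + 1)) t) - b (min (π i) t))‖
      ≤ ∑ i ∈ Finset.range L, (K * δ) * ‖b (min (π (i + 1)) t) - b (min (π i) t)‖ := by
        refine Finset.sum_le_sum fun i hi => ?_
        rw [norm_mul]
        gcongr
        have hle : min (π i) t ≤ min (π (i + 1)) t := min_le_min_right _ (h1 i.le_succ)
        refine (ha _ _ hle).trans ?_
        gcongr
        have h5 : ((π (i + 1) : ℝ≥0) : ℝ) ≤ π i + δ := h4 i (Finset.mem_range.1 hi)
        rw [NNReal.coe_min, NNReal.coe_min]
        rcases le_total (π i : ℝ) t with h | h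
        · rw [min_eq_left h]
          linarith [min_le_left (π (i + 1) : ℝ) t]
        · rw [min_eq_right h]
          linarith [min_le_right (π (i + 1) : ℝ) t]
    _ ≤ (K * δ) * B := by
        rw [← Finset.mul_sum]
        gcongr
        exact hb L π h1 h2 h3 t ht
    _ ≤ ((K + 1) * (B + 1)) * δ := by
        have : 0 ≤ (K + B + 1) * δ := by positivity
        nlinarith
    _ = ε := by rw [hδ]; field_simp

end HasCovariation

/-- The indicator of `[τ, ∞)`. -/
def unitStep (τ t : ℝ≥0) : ℂ := if τ ≤ t then 1 else 0

section UnitStep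

variable {T : ℝ≥0}

theorem sum_increments_eq {L : ℕ} {π : ℕ → ℝ≥0} (h0 : π 0 = 0) (hL : π L = T) {t : ℝ≥0} (ht : t ≤ T)
    {G : Type*} [AddCommGroup G] (g : ℝ≥0 → G) :
    ∑ i ∈ Finset.range L, (g (min (π (i + 1)) t) - g (min (π i) t)) = g t - g 0 := by
  rw [Finset.sum_range_sub fun i => g (min (π i) t), h0, hL, min_eq_right ht,
    min_eq_left (zero_le)]

theorem variation_le_of_lipschitz {K : ℝ} (hK : 0 ≤ K) {b : ℝ≥0 → ℂ}
    (hb : ∀ s t : ℝ≥0, s ≤ t → ‖b t - b s‖ ≤ K * ((t : ℝ) - s)) (L : ℕ) (π : ℕ → ℝ≥0)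
    (hπ : Monotone π) (h0 : π 0 = 0) (hL : π L = T) (t : ℝ≥0) (ht : t ≤ T) :
    ∑ i ∈ Finset.range L, ‖b (min (π (i + 1)) t) - b (min (π i) t)‖ ≤ K * T := by
  calc ∑ i ∈ Finset.range L, ‖b (min (π (i + 1)) t) - b (min (π i) t)‖
      ≤ ∑ i ∈ Finset.range L,
          (K * ((min (π (i + 1)) t : ℝ≥0) : ℝ) - K * ((min (π i) t : ℝ≥0) : ℝ)) :=
        Finset.sum_le_sum fun i _ => by
          rw [← mul_sub]
          exact hb _ _ (min_le_min_right _ (hπ i.le_succ))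
    _ = K * t - K * (0 : ℝ≥0) := sum_increments_eq h0 hL ht fun s => K * (s : ℝ)
    _ ≤ K * T := by
        rw [NNReal.coe_zero, mul_zero, sub_zero]
        gcongr

theorem norm_unitStep_sub (τ : ℝ≥0) {s t : ℝ≥0} (hst : s ≤ t) :
    ‖unitStep τ t - unitStep τ s‖ = (unitStep τ t - unitStep τ s).re := by
  rw [unitStep, unitStep]
  split_ifs with h1 h2 h2
  · simp
  · simp
  · exact absurd (h2.trans hst) h1
  · simp

theorem variation_unitStep_le (τ : ℝ≥0) (L : ℕ) (π : ℕ → ℝ≥0) (hπ : Monotone π) (h0 : π 0 = 0)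
    (hL : π L = T) (t : ℝ≥0) (ht : t ≤ T) :
    ∑ i ∈ Finset.range L, ‖unitStep τ (min (π (i + 1)) t) - unitStep τ (min (π i) t)‖ ≤ 1 := by
  have h : ∀ i ∈ Finset.range L, ‖unitStep τ (min (π (i + 1)) t) - unitStep τ (min (π i) t)‖ =
      (unitStep τ (min (π (i + 1)) t)).re - (unitStep τ (min (π i) t)).re := fun i _ => by
    rw [norm_unitStep_sub τ (min_le_min_right _ (hπ i.le_succ)), Complex.sub_re]
  rw [Finset.sum_congr rfl h, sum_increments_eq h0 hL ht fun s => (unitStep τ s).re]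
  rw [unitStep, unitStep]
  split_ifs <;> simp

/-- Each increment is 0 or 1, hence equal to its square, and the sum telescopes exactly for any
mesh. Positivity of τ matters: a step at 0 would contribute no increment. -/
theorem hasCovariation_unitStep_self {τ : ℝ≥0} (hτ : 0 < τ) (T : ℝ≥0) :
    HasCovariation T (unitStep τ) (unitStep τ) (unitStep τ) := by
  intro ε hε
  refine ⟨1, one_pos, fun L π h1 h2 h3 _ t ht => ?_⟩
  have h : incrementSum L π (unitStep τ) (unitStep τ) t = unitStep τ t := by
    have h0 : unitStep τ 0 = 0 := if_neg (not_le.2 hτ)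
    rw [← sub_zero (unitStep τ t), ← h0, ← sum_increments_eq h2 h3 ht]
    refine Finset.sum_congr rfl fun i _ => ?_
    have hle : min (π i) t ≤ min (π (i + 1)) t := min_le_min_right _ (h1 i.le_succ)
    rw [unitStep, unitStep]
    split_ifs with h5 h6 h6
    · simp
    · simp
    · exact absurd (h6.trans hle) h5
    · simp
  rw [h, sub_self, norm_zero]
  exact hε.le

/-- Once the mesh is below the gap σ - τ, no partition interval sees both steps, and every product
of increments vanishes. -/
theorem hasCovariation_unitStep_of_lt {τ σ : ℝ≥0} (hτσ : τ < σ) (T : ℝ≥0) :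
    HasCovariation T (unitStep τ) (unitStep σ) fun _ => 0 := by
  intro ε hε
  obtain ⟨δ, hδ, hδ'⟩ : ∃ δ : ℝ≥0, 0 < δ ∧ τ + δ < σ := by
    obtain ⟨m, h1, h2⟩ := exists_between hτσ
    exact ⟨m - τ, tsub_pos_of_lt h1, by rwa [add_tsub_cancel_of_le h1.le]⟩
  refine ⟨δ, hδ, fun L π h1 _ _ h4 t _ => ?_⟩
  have h : incrementSum L π (unitStep τ) (unitStep σ) t = 0 := by
    refine Finset.sum_eq_zero fun i hi => ?_
    have hle : min (π i) t ≤ min (π (i + 1)) t := min_le_min_right _ (h1 i.le_succ)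
    have hgap : min (π (i + 1)) t ≤ min (π i) t + δ := by
      rw [min_add]
      exact min_le_min (h4 i (Finset.mem_range.1 hi)) le_self_add
    by_cases h5 : τ ≤ min (π i) t
    · rw [unitStep, unitStep, if_pos h5, if_pos (h5.trans hle), sub_self, zero_mul]
    · have h6 : ¬ σ ≤ min (π (i + 1)) t := fun h6 => by
        have := (h6.trans hgap).trans_lt (add_lt_add_left (not_le.1 h5) δ)
        exact absurd hδ' (not_lt.2 this.le)
      have h7 : ¬ σ ≤ min (π i) t := fun h7 => h6 (h7.trans hle)
      rw [unitStep.eq_1 σ, unitStep.eq_1 σ, if_neg h6, if_neg h7, sub_self, mul_zero]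
  rw [h, sub_zero, norm_zero]
  exact hε.le

theorem hasCovariation_unitStep {τ σ : ℝ≥0} (hτ : 0 < τ) (T : ℝ≥0) :
    HasCovariation T (unitStep τ) (unitStep σ) fun t => if τ = σ then unitStep τ t else 0 := by
  rcases lt_trichotomy τ σ with h | rfl | h
  · simpa [h.ne] using hasCovariation_unitStep_of_lt h T
  · simpa using hasCovariation_unitStep_self hτ T
  · simpa [h.ne'] using (hasCovariation_unitStep_of_lt h T).symm

theorem eventually_unitStep_eq (τ t : ℝ≥0) : ∀ᶠ u in 𝓝[≥] t, unitStep τ u = unitStep τ t := by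
  rcases le_or_gt τ t with h | h
  · filter_upwards [eventually_mem_nhdsWithin] with u hu
    rw [unitStep, unitStep, if_pos h, if_pos (h.trans hu)]
  · filter_upwards [nhdsWithin_le_nhds (Iio_mem_nhds h)] with u hu
    rw [unitStep, unitStep, if_neg (not_le.2 h), if_neg (not_le.2 hu)]

end UnitStep

/-- On `[0, T]` the path `a` is the sum of a Lipschitz path and of the step path with jumps `α` at
the times in `J`. -/
def IsStepLipschitz (T : ℝ≥0) (J : Finset ℝ≥0) (α a : ℝ≥0 → ℂ) : Prop :=
  ∃ (c : ℝ≥0 → ℂ) (K : ℝ), 0 ≤ K ∧ (∀ s t : ℝ≥0, s ≤ t → ‖c t - c s‖ ≤ K * ((t : ℝ) - s)) ∧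
    ∀ t ≤ T, a t = c t + ∑ τ ∈ J, α τ * unitStep τ t

namespace IsStepLipschitz

variable {T : ℝ≥0} {J : Finset ℝ≥0} {α β a b : ℝ≥0 → ℂ}

theorem conj (ha : IsStepLipschitz T J α a) :
    IsStepLipschitz T J (fun t => starRingEnd ℂ (α t)) fun t => starRingEnd ℂ (a t) := by
  obtain ⟨c, K, hK, hc, h⟩ := ha
  refine ⟨fun t => starRingEnd ℂ (c t), K, hK, fun s t hst => ?_, fun t ht => ?_⟩
  · rw [← map_sub, Complex.norm_conj]
    exact hc s t hst
  · have hu : ∀ τ, starRingEnd ℂ (unitStep τ t) = unitStep τ t := fun τ => by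
      rw [unitStep]; split_ifs <;> simp
    simp only [h t ht, map_add, map_sum, map_mul, hu]

/-- Expand bilinearly. Every term with a Lipschitz factor vanishes, since the other factor has
bounded variation; among pairs of steps only the diagonal survives. -/
theorem hasCovariation (hJ : ∀ τ ∈ J, 0 < τ) (ha : IsStepLipschitz T J α a)
    (hb : IsStepLipschitz T J β b) :
    HasCovariation T a b fun t => ∑ τ ∈ J, α τ * β τ * unitStep τ t := by
  obtain ⟨c, K, hK, hc, h⟩ := ha
  obtain ⟨d, M, hM, hd, h'⟩ := hb
  have h1 : HasCovariation T c d fun _ => 0 :=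
    .of_lipschitz hK (by positivity) hc (variation_le_of_lipschitz hM hd)
  have h2 := HasCovariation.sum_right (J := J) (T := T) (a := c)
    (b := fun τ t => β τ * unitStep τ t) (V := fun τ _ => β τ * 0) fun τ _ =>
      (HasCovariation.of_lipschitz hK zero_le_one hc (variation_unitStep_le τ)).const_mul_right (β τ)
  have h3 := HasCovariation.sum_left (J := J) (T := T) (b := d)
    (a := fun τ t => α τ * unitStep τ t) (V := fun τ _ => α τ * 0) fun τ _ =>
      (HasCovariation.of_lipschitz hM zero_le_one hd
        (variation_unitStep_le τ)).symm.const_mul_left (α τ)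
  have h4 := HasCovariation.sum_left (J := J) (T := T) (a := fun τ t => α τ * unitStep τ t)
    fun τ hτ => HasCovariation.sum_right (J := J) (b := fun σ t => β σ * unitStep σ t) fun σ _ =>
      ((hasCovariation_unitStep (σ := σ) (hJ τ hτ) T).const_mul_left (α τ)).const_mul_right (β σ)
  refine ((h1.add_right h2).add_left (h3.add_right h4)).congr h h' fun t _ => ?_
  simp only [mul_zero, Finset.sum_const_zero, zero_add]
  refine Finset.sum_congr rfl fun τ hτ => ?_
  rw [Finset.sum_eq_single τ]
  · rw [if_pos rfl]; ring
  · intro σ _ hne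
    rw [if_neg hne.symm, mul_zero, mul_zero]
  · exact fun h => absurd hτ h

theorem rightContinuous (ha : IsStepLipschitz T J α a) {t : ℝ≥0} (ht : t < T) :
    ContinuousWithinAt a (Set.Ici t) t := by
  obtain ⟨c, K, hK, hc, h⟩ := ha
  have hcc : Continuous c := by
    refine (LipschitzWith.of_dist_le_mul (K := ⟨K, hK⟩) fun s t => ?_).continuous
    rcases le_total s t with hst | hst
    · rw [dist_comm, dist_comm s t, dist_eq_norm, NNReal.dist_eq,
        abs_of_nonneg (sub_nonneg.2 (NNReal.coe_le_coe.2 hst))]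
      exact hc s t hst
    · rw [dist_eq_norm, NNReal.dist_eq, abs_of_nonneg (sub_nonneg.2 (NNReal.coe_le_coe.2 hst))]
      exact hc t s hst
  have hs : ContinuousWithinAt (fun t => c t + ∑ τ ∈ J, α τ * unitStep τ t) (Set.Ici t) t := by
    refine hcc.continuousWithinAt.add (tendsto_finsetSum _ fun τ _ => ?_)
    exact tendsto_const_nhds.mul (tendsto_const_nhds.congr'
      ((eventually_unitStep_eq τ t).mono fun u hu => hu.symm))
  refine hs.congr_of_eventuallyEq ?_ (h t ht.le)
  filter_upwards [nhdsWithin_le_nhds (Iio_mem_nhds ht)] with u hu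
  exact h u (le_of_lt hu)

end IsStepLipschitz

theorem incrementSum_rightContinuous {T : ℝ≥0} {a b : ℝ≥0 → ℂ}
    (ha : ∀ t < T, ContinuousWithinAt a (Set.Ici t) t)
    (hb : ∀ t < T, ContinuousWithinAt b (Set.Ici t) t) (L : ℕ) (π : ℕ → ℝ≥0) {t : ℝ≥0}
    (ht : t < T) : ContinuousWithinAt (incrementSum L π a b) (Set.Ici t) t := by
  have h : ∀ {a : ℝ≥0 → ℂ}, (∀ t < T, ContinuousWithinAt a (Set.Ici t) t) → ∀ p,
      ContinuousWithinAt (fun t => a (min p t)) (Set.Ici t) t := fun {a} ha p =>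
    (ha (min p t) ((min_le_right _ _).trans_lt ht)).comp (t := Set.Ici (min p t))
      (f := fun t => min p t) (continuous_const.min continuous_id).continuousWithinAt
      fun r hr => min_le_min_left p hr
  exact tendsto_finsetSum _ fun i _ => ((h ha _).sub (h ha _)).mul ((h hb _).sub (h hb _))

/-! ### From pathwise covariation to covariation in probability. -/

section Probability

variable {Ω : Type*} [MeasurableSpace Ω] {T : ℝ≥0} {M N V : ℝ≥0 → Ω → ℂ}

theorem measurable_incrementSum (hM : ∀ t ≤ T, Measurable (M t)) (hN : ∀ t ≤ T, Measurable (N t))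
    (L : ℕ) (π : ℕ → ℝ≥0) {t : ℝ≥0} (ht : t ≤ T) :
    Measurable fun ω => incrementSum L π (fun t => M t ω) (fun t => N t ω) t := by
  have hm : ∀ p, min p t ≤ T := fun p => (min_le_right _ _).trans ht
  exact Finset.measurable_fun_sum _ fun i _ =>
    ((hM _ (hm _)).sub (hM _ (hm _))).mul ((hN _ (hm _)).sub (hN _ (hm _)))

/-- V is a pointwise limit of the measurable sums along equal partitions of [0, T]. -/
theorem measurable_of_hasCovariation (hM : ∀ t ≤ T, Measurable (M t))
    (hN : ∀ t ≤ T, Measurable (N t))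
    (h : ∀ ω, HasCovariation T (fun t => M t ω) (fun t => N t ω) fun t => V t ω) {t : ℝ≥0}
    (ht : t ≤ T) : Measurable (V t) := by
  set π : ℕ → ℕ → ℝ≥0 := fun k i => min (i * (T / (k + 1))) T with hπ
  refine measurable_of_tendsto_metrizable
    (f := fun k ω => incrementSum (k + 1) (π k) (fun t => M t ω) (fun t => N t ω) t)
    (fun k => measurable_incrementSum hM hN _ _ ht) ?_
  rw [tendsto_pi_nhds]
  intro ω
  rw [tendsto_iff_norm_sub_tendsto_zero, Metric.tendsto_atTop]
  intro ε hε
  obtain ⟨δ, hδ, H⟩ := h ω (ε / 2) (half_pos hε)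
  have hlim : Tendsto (fun k : ℕ => T / ((k : ℝ≥0) + 1)) atTop (𝓝 0) := by
    have := (tendsto_one_div_add_atTop_nhds_zero_nat (𝕜 := ℝ≥0)).const_mul T
    simpa [div_eq_mul_inv] using this
  obtain ⟨k₀, hk₀⟩ := eventually_atTop.1 (hlim.eventually (Iio_mem_nhds hδ))
  refine ⟨k₀, fun k hk => ?_⟩
  rw [dist_zero_right, norm_norm]
  refine (H (k + 1) (π k) ?_ ?_ ?_ ?_ t ht).trans_lt (half_lt_self hε)
  · intro i j hij
    simp only [hπ]
    gcongr
  · simp [hπ]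
  · simp only [hπ]
    rw [Nat.cast_add_one, mul_div_cancel₀ T (by positivity), min_self]
  · intro i _
    have h5 : T / ((k : ℝ≥0) + 1) ≤ δ := (hk₀ k hk).le
    simp only [hπ]
    rw [min_add, Nat.cast_add_one, add_mul, one_mul]
    exact min_le_min (by gcongr) le_self_add

/-- Pathwise uniform covariation of right-continuous processes implies covariation in
probability. -/
theorem isQuadraticCovariation_of_hasCovariation (P : Measure Ω) [IsProbabilityMeasure P]
    (hM : ∀ t ≤ T, Measurable (M t)) (hN : ∀ t ≤ T, Measurable (N t))
    (h : ∀ ω, HasCovariation T (fun t => M t ω) (fun t => N t ω) fun t => V t ω)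
    (hMr : ∀ ω, ∀ t < T, ContinuousWithinAt (fun t => M t ω) (Set.Ici t) t)
    (hNr : ∀ ω, ∀ t < T, ContinuousWithinAt (fun t => N t ω) (Set.Ici t) t)
    (hVr : ∀ ω, ∀ t < T, ContinuousWithinAt (fun t => V t ω) (Set.Ici t) t) :
    IsQuadraticCovariation P T M N V := by
  intro L π hπ h0 hL hmesh ε hε
  obtain ⟨S, hSc, hSd⟩ := TopologicalSpace.exists_countable_dense ℝ≥0
  set D : ℕ → ℝ≥0 → Ω → ℂ := fun k t ω =>
    incrementSum (L k) (π k) (fun t => M t ω) (fun t => N t ω) t - V t ω with hD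
  -- The bad event is a union over uncountably many t. Right-continuity puts it inside this
  -- measurable countable union: the strict inequality at the lower threshold ε / 2 persists just to
  -- the right of t. Capping q at T accounts for t = T.
  set B : ℕ → Set Ω := fun k => ⋃ q ∈ S, {ω | ε / 2 < ‖D k (min q T) ω‖} with hB
  have hBm : ∀ k, MeasurableSet (B k) := fun k =>
    MeasurableSet.biUnion hSc fun q _ => measurableSet_lt measurable_const
      ((measurable_incrementSum hM hN _ _ (min_le_right _ _)).sub
        (measurable_of_hasCovariation hM hN h (min_le_right _ _))).norm
  have hB0 : Tendsto (fun k => P (B k)) atTop (𝓝 0) := by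
    -- For each ω the pathwise bound excludes ω from B k for all large k, so the indicators tend to
    -- 0 everywhere.
    have := tendsto_measure_of_tendsto_indicator_of_isFiniteMeasure (A := ∅) atTop P hBm
      fun ω => ?_
    · simpa using this
    obtain ⟨δ, hδ, H⟩ := h ω (ε / 2) (half_pos hε)
    filter_upwards [hmesh δ hδ] with k hk
    simp only [hB, Set.mem_iUnion, Set.mem_ofPred_eq, Set.mem_empty_iff_false, iff_false, not_exists,
      not_lt]
    exact fun q _ => H (L k) (π k) (hπ k) (h0 k) (hL k) hk _ (min_le_right _ _)
  refine tendsto_of_tendsto_of_tendsto_of_le_of_le tendsto_const_nhds hB0 (fun _ => zero_le)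
    fun k => measure_mono ?_
  rintro ω ⟨t, htT, ht⟩
  have ht' : ε / 2 < ‖D k t ω‖ := (half_lt_self hε).trans_le ht
  simp only [hB, Set.mem_iUnion, Set.mem_ofPred_eq]
  rcases htT.eq_or_lt with rfl | hlt
  · obtain ⟨q, hq, hqS⟩ := hSd.exists_gt t
    exact ⟨q, hq, by rwa [min_eq_right (le_of_lt hqS)]⟩
  · have hr : ContinuousWithinAt (fun t => D k t ω) (Set.Ici t) t :=
      (incrementSum_rightContinuous (hMr ω) (hNr ω) (L k) (π k) hlt).sub (hVr ω t hlt)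
    have hev : ∀ᶠ u in 𝓝[≥] t, ε / 2 < ‖D k u ω‖ := hr.norm.eventually (Ioi_mem_nhds ht')
    obtain ⟨u, hu, hu'⟩ := (mem_nhdsGE_iff_exists_Ico_subset' hlt).1 hev
    obtain ⟨q, hq, hqS⟩ := hSd.exists_between (lt_min hu hlt)
    refine ⟨q, hq, ?_⟩
    rw [min_eq_left (hqS.2.trans_le (min_le_right _ _)).le]
    exact hu' ⟨hqS.1.le, hqS.2.trans_le (min_le_left _ _)⟩

end Probability

/-! ### The characteristic curve and the test function along it. -/

theorem norm_stieltjes_le (μ : Measure ℝ) [IsProbabilityMeasure μ] {w : ℂ} {c : ℝ} (hc : 0 < c)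
    (hw : c ≤ |w.im|) : ‖stieltjes μ w‖ ≤ c⁻¹ := by
  rw [stieltjes_eq]
  refine (norm_integral_le_of_norm_le_const (C := c⁻¹) (.of_forall fun x => ?_)).trans (by simp)
  rw [norm_div, norm_one, one_div]
  exact inv_anti₀ hc (le_norm_ofReal_sub x hw)

/-- The curve `ζ` on `[0, T]`, extended by constants. -/
def clampCurve (T : ℝ≥0) (ζ : ℝ → ℂ) (s : ℝ) : ℂ := ζ (Set.projIcc 0 (T : ℝ) T.coe_nonneg s)

theorem clampCurve_of_mem {T : ℝ≥0} {ζ : ℝ → ℂ} {s : ℝ} (hs : s ∈ Set.Icc 0 (T : ℝ)) :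
    clampCurve T ζ s = ζ s := by
  rw [clampCurve, Set.projIcc_of_mem _ hs]

section Characteristic

variable {μ : ℝ≥0 → ProbabilityMeasure ℝ} {T : ℝ≥0} {z : ℂ} {ζ : ℝ → ℂ}

/-- By compactness |Im z_s| attains a positive minimum on [0, T]; this constant c controls every
later bound along the curve. -/
theorem IsCharacteristic.exists_le_abs_im (h : IsCharacteristic μ T z ζ) :
    ∃ c : ℝ, 0 < c ∧ ∀ s, c ≤ |(clampCurve T ζ s).im| := by
  have hc : ContinuousOn (fun s => |(ζ s).im|) (Set.Icc 0 (T : ℝ)) :=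
    (Complex.continuous_im.comp_continuousOn
      fun t ht => (h.hasDeriv t ht).continuousWithinAt).abs
  obtain ⟨r, hr, hmin⟩ := isCompact_Icc.exists_isMinOn
    (Set.nonempty_Icc.2 T.coe_nonneg) hc
  exact ⟨|(ζ r).im|, abs_pos.2 (h.im_ne_zero r hr), fun s => hmin (Subtype.coe_prop _)⟩

theorem IsCharacteristic.lipschitz (h : IsCharacteristic μ T z ζ) {c : ℝ} (hc : 0 < c)
    (hcζ : ∀ s, c ≤ |(clampCurve T ζ s).im|) (s r : ℝ) :
    ‖clampCurve T ζ s - clampCurve T ζ r‖ ≤ Real.exp c⁻¹ * |s - r| := by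
  have hb : ∀ t ∈ Set.Icc (0 : ℝ) T,
      ‖Complex.exp (-stieltjes (μ t.toNNReal) (ζ t))‖ ≤ Real.exp c⁻¹ := by
    intro t ht
    rw [Complex.norm_exp]
    refine Real.exp_le_exp.2 ((Complex.re_le_norm _).trans ?_)
    rw [norm_neg]
    refine norm_stieltjes_le _ hc ?_
    rw [← clampCurve_of_mem (ζ := ζ) ht]
    exact hcζ t
  have h1 := Convex.norm_image_sub_le_of_norm_hasDerivWithin_le h.hasDeriv hb (convex_Icc _ _)
    (Set.projIcc 0 (T : ℝ) T.coe_nonneg r).2 (Set.projIcc 0 (T : ℝ) T.coe_nonneg s).2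
  refine h1.trans ?_
  gcongr
  exact Set.abs_projIcc_sub_projIcc T.coe_nonneg

theorem IsCharacteristic.hasDerivWithinAt_clampCurve (h : IsCharacteristic μ T z ζ) {s : ℝ}
    (hs : s ∈ Set.Ico 0 (T : ℝ)) :
    HasDerivWithinAt (clampCurve T ζ) (Complex.exp (-stieltjes (μ s.toNNReal) (ζ s)))
      (Set.Ici s) s := by
  have hmem : Set.Icc 0 (T : ℝ) ∈ 𝓝[≥] s :=
    mem_of_superset (Ico_mem_nhdsGE hs.2) fun u hu => ⟨hs.1.trans hu.1, hu.2.le⟩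
  refine ((h.hasDeriv s ⟨hs.1, hs.2.le⟩).mono_of_mem_nhdsWithin hmem).congr_of_eventuallyEq ?_
    (clampCurve_of_mem ⟨hs.1, hs.2.le⟩)
  filter_upwards [hmem] with u hu
  exact clampCurve_of_mem hu

/-- Clamping may create corners at 0 and T, but right derivatives exist at all times. This is why
test families only require right differentiability. -/
theorem IsCharacteristic.differentiableWithinAt_clampCurve (h : IsCharacteristic μ T z ζ) (s : ℝ) :
    DifferentiableWithinAt ℝ (clampCurve T ζ) (Set.Ici s) s := by
  rcases lt_or_ge s 0 with h0 | h0
  · refine (differentiableWithinAt_const (ζ 0)).congr_of_eventuallyEq ?_ ?_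
    · filter_upwards [nhdsWithin_le_nhds (Iio_mem_nhds h0)] with u hu
      rw [clampCurve, Set.projIcc_of_le_left _ (le_of_lt hu)]
    · rw [clampCurve, Set.projIcc_of_le_left _ h0.le]
  rcases lt_or_ge s T with hT | hT
  · exact (h.hasDerivWithinAt_clampCurve ⟨h0, hT⟩).differentiableWithinAt
  · refine (differentiableWithinAt_const (ζ T)).congr (fun u hu => ?_) ?_
    · rw [clampCurve, Set.projIcc_of_right_le _ (hT.trans hu)]
    · rw [clampCurve, Set.projIcc_of_right_le _ hT]

/-- The Stieltjes transform of the empirical measure along the clamped curve. -/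
def stieltjesAlong {n : ℕ} (θ : ℝ) (T : ℝ≥0) (ζ : ℝ → ℂ) (s : ℝ) (x : Fin n → ℝ) : ℂ :=
  stieltjes (empirical θ x) (clampCurve T ζ s)

theorem IsCharacteristic.isTestFamily (h : IsCharacteristic μ T z ζ) (n : ℕ) (θ : ℝ) {c : ℝ}
    (hc : 0 < c) (hcζ : ∀ s, c ≤ |(clampCurve T ζ s).im|) :
    IsTestFamily (n := n) c⁻¹ (c⁻¹ * c⁻¹ * Real.exp c⁻¹) (stieltjesAlong θ T ζ) where
  norm_le s x := norm_stieltjes_empirical_le x hc (hcζ s)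
  lipschitz s r x := by
    refine (norm_stieltjes_empirical_sub_le x hc (hcζ s) (hcζ r)).trans ?_
    rw [mul_assoc (c⁻¹ * c⁻¹)]
    exact mul_le_mul_of_nonneg_left (h.lipschitz hc hcζ s r) (by positivity)
  differentiable s x :=
    ((differentiableAt_stieltjes_empirical x
      (abs_pos.1 (hc.trans_le (hcζ s)))).hasDerivAt.comp_hasDerivWithinAt s
        (h.differentiableWithinAt_clampCurve s).hasDerivWithinAt).differentiableWithinAt

theorem IsCharacteristic.timeDeriv_stieltjesAlong (h : IsCharacteristic μ T z ζ) {n : ℕ} (θ : ℝ)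
    (x : Fin n → ℝ) {s : ℝ} (hs : s ∈ Set.Ico 0 (T : ℝ)) :
    timeDeriv (stieltjesAlong θ T ζ) s x =
      deriv (stieltjes (empirical θ x)) (ζ s) * Complex.exp (-stieltjes (μ s.toNNReal) (ζ s)) := by
  have hm : s ∈ Set.Icc 0 (T : ℝ) := ⟨hs.1, hs.2.le⟩
  have h1 := (differentiableAt_stieltjes_empirical (θ := θ) x (h.im_ne_zero s hm)).hasDerivAt
  rw [← clampCurve_of_mem (ζ := ζ) hm] at h1
  have h2 := h1.comp_hasDerivWithinAt s (h.hasDerivWithinAt_clampCurve hs)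
  have h3 := h2.derivWithin (uniqueDiffWithinAt_Ici s)
  rw [clampCurve_of_mem (ζ := ζ) hm] at h3
  exact h3

theorem IsCharacteristic.complexGenerator_stieltjesAlong (h : IsCharacteristic μ T z ζ) {n : ℕ}
    (hn : 0 < n) {θ : ℝ} (hθ : 0 < θ) {x : Fin n → ℝ} (hx : x ∈ chamber n θ) {s : ℝ}
    (hs : s ∈ Set.Icc 0 (T : ℝ)) :
    complexGenerator θ (stieltjesAlong θ T ζ s) x = nekrasovDrift θ x (ζ s) := by
  rw [← complexGenerator_stieltjes hn hθ hx (h.im_ne_zero s hs)]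
  simp only [stieltjesAlong, complexGenerator, clampCurve_of_mem hs]

end Characteristic

theorem tsum_Icc_eq_sum {J : Finset ℝ≥0} {E : Type*} [AddCommMonoid E] [TopologicalSpace E]
    {t : ℝ≥0} {g : ℝ≥0 → E} (hg : ∀ s ≤ t, s ∉ J → g s = 0) :
    ∑' s : Set.Icc (0 : ℝ≥0) t, g s = ∑ τ ∈ J, if τ ≤ t then g τ else 0 := by
  classical
  rw [tsum_subtype, tsum_eq_sum (s := J)]
  · refine Finset.sum_congr rfl fun τ _ => ?_
    simp [Set.indicator_apply]
  · intro s hs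
    rw [Set.indicator_apply]
    split_ifs with hm
    · exact hg s hm.2 hs
    · rfl

/-! ### Path decomposition of the martingale and its brackets. -/

section Decomposition

variable {Ω : Type*} {mΩ : MeasurableSpace Ω} {n : ℕ} {θ : ℝ} {P : Measure Ω}
  {ℱ : Filtration ℝ≥0 mΩ} {X : ℝ≥0 → Ω → chamber n θ} {C K : ℝ} {F : ℝ → (Fin n → ℝ) → ℂ}

theorem IsWalk.dynkinMartingale_eq (hX : IsWalk θ P ℱ X) (hθ : 0 < θ) (hF : IsTestFamily C K F)
    (t : ℝ≥0) (ω : Ω) :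
    dynkinMartingale θ X F t ω = F t (X t ω) - F 0 (X 0 ω) -
      (∫ r in (0 : ℝ)..t, timeDeriv F r (X r.toNNReal ω)) -
      ∫ r in (0 : ℝ)..t, complexGenerator θ (F r) (X r.toNNReal ω) := by
  have h1 := hX.intervalIntegrable (G := timeDeriv F) IsTestFamily.measurable_timeDeriv
    (fun s x _ => hF.norm_timeDeriv_le s x) ω 0 t
  have h2 := hX.intervalIntegrable (G := fun s => complexGenerator θ (F s))
    hF.measurable_generator (fun s x hx => norm_complexGenerator_le hθ (hF.norm_le s) hx) ω 0 t
  have h3 := intervalIntegral.integral_add h1 h2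
  rw [dynkinMartingale, sub_sub (F t (X t ω) - F 0 (X 0 ω)), ← h3]
  rfl

/-- The integral of the time derivative cancels the evolution of F between jumps. What remains is
the sum of the jumps minus the integral of the generator term, which is Lipschitz in t because that
term is bounded. -/
theorem IsWalk.isStepLipschitz_dynkinMartingale (hX : IsWalk θ P ℱ X) (hθ : 0 < θ)
    (hF : IsTestFamily C K F) (T : ℝ≥0) (ω : Ω) {J : Finset ℝ≥0}
    (hJ : ∀ s, s ∈ J ↔ s ∈ jumpTimes (fun t => X t ω) ∩ Set.Icc 0 T) :
    IsStepLipschitz T J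
      (fun τ => jumpAt (fun y : chamber n θ => F τ y) (fun t => X t ω) τ)
      fun t => dynkinMartingale θ X F t ω := by
  have hi := hX.intervalIntegrable (G := fun s => complexGenerator θ (F s))
    hF.measurable_generator (fun s x hx => norm_complexGenerator_le hθ (hF.norm_le s) hx) ω
  have hC : 0 ≤ C := (norm_nonneg _).trans (hF.norm_le 0 0)
  refine ⟨fun t => -∫ r in (0 : ℝ)..t, complexGenerator θ (F r) (X r.toNNReal ω),
    n * ((θ * n * 2 ^ n) * (C + C)), by positivity, fun s t hst => ?_, fun t ht => ?_⟩
  · have hst' : (s : ℝ) ≤ t := hst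
    rw [neg_sub_neg, norm_sub_rev, intervalIntegral.integral_interval_sub_left (hi _ _) (hi _ _)]
    refine (intervalIntegral.norm_integral_le_of_norm_le_const
      fun r _ => norm_complexGenerator_le hθ (hF.norm_le r) (X _ ω).2).trans ?_
    rw [abs_of_nonneg (sub_nonneg.2 hst')]
  · have h := (hX.cadlag ω).sub_eq_integral_add_sum_jumps hJ
      (F := fun s (y : chamber n θ) => F s y) (F' := fun s y => timeDeriv F s y)
      (fun y => hF.continuous y)
      (fun s y => (hF.differentiable s y).hasDerivWithinAt.mono Set.Ioi_subset_Ici_self)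
      (fun a b => hX.intervalIntegrable (G := timeDeriv F) IsTestFamily.measurable_timeDeriv
        (fun s x _ => hF.norm_timeDeriv_le s x) ω a b) ht
    beta_reduce
    rw [hX.dynkinMartingale_eq hθ hF, h, sub_eq_neg_add]
    congr 1
    exact Finset.sum_congr rfl fun τ _ => by rw [unitStep]; split_ifs <;> simp

end Decomposition

section Characteristic

variable {Ω : Type*} {mΩ : MeasurableSpace Ω} {n : ℕ} {θ : ℝ} {P : Measure Ω}
  {ℱ : Filtration ℝ≥0 mΩ} {X : ℝ≥0 → Ω → chamber n θ} {C K : ℝ} {T : ℝ≥0} {ζ : ℝ → ℂ}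

theorem stieltjesJump_eq_jumpAt (x : ℝ≥0 → chamber n θ) (w : ℂ) (s : ℝ≥0) :
    stieltjesJump θ x w s =
      jumpAt (fun y : chamber n θ => stieltjes (empirical (n := n) θ y) w) x s := by
  rw [stieltjesJump, jumpAt]

theorem stieltjesJump_of_notMem {x : ℝ≥0 → chamber n θ} {s : ℝ≥0} (w : ℂ) (hs : s ∉ jumpTimes x) :
    stieltjesJump θ x w s = 0 := by
  rw [stieltjesJump_eq_jumpAt, jumpAt_of_notMem _ hs]

/-- The covariation of the martingale `M` with `σ M`, for `σ` the identity or the complex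
conjugation, is the sum of the products of the jumps. -/
theorem IsWalk.isQuadraticCovariation_stieltjes [IsProbabilityMeasure P] (hX : IsWalk θ P ℱ X)
    (hθ : 0 < θ) (hF : IsTestFamily (n := n) C K (stieltjesAlong θ T ζ)) (σ : ℂ → ℂ)
    (hσm : Measurable σ)
    (hσ : ∀ (J : Finset ℝ≥0) (α a : ℝ≥0 → ℂ), IsStepLipschitz T J α a →
      IsStepLipschitz T J (fun t => σ (α t)) fun t => σ (a t)) :
    IsQuadraticCovariation P T (dynkinMartingale θ X (stieltjesAlong θ T ζ))
      (fun t ω => σ (dynkinMartingale θ X (stieltjesAlong θ T ζ) t ω))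
      (fun t ω => ∑' s : Set.Icc (0 : ℝ≥0) t,
        stieltjesJump θ (fun u => X u ω) (ζ (s : ℝ≥0)) s *
          σ (stieltjesJump θ (fun u => X u ω) (ζ (s : ℝ≥0)) s)) := by
  set M := dynkinMartingale θ X (stieltjesAlong θ T ζ) with hM
  have hMm : ∀ t ≤ T, Measurable (M t) := fun t _ =>
    ((hX.stronglyMeasurable_dynkinMartingale hF t).measurable).mono (ℱ.le t) le_rfl
  have key : ∀ ω, ∃ (J : Finset ℝ≥0) (α : ℝ≥0 → ℂ), (∀ τ ∈ J, 0 < τ) ∧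
      IsStepLipschitz T J α (fun t => M t ω) ∧
      ∀ t ≤ T, ∑' s : Set.Icc (0 : ℝ≥0) t,
        stieltjesJump θ (fun u => X u ω) (ζ (s : ℝ≥0)) s *
          σ (stieltjesJump θ (fun u => X u ω) (ζ (s : ℝ≥0)) s) =
        ∑ τ ∈ J, α τ * σ (α τ) * unitStep τ t := by
    intro ω
    have hfin := (hX.cadlag ω).finite_jumpTimes T
    have hJ : ∀ s, s ∈ hfin.toFinset ↔ s ∈ jumpTimes (fun t => X t ω) ∩ Set.Icc 0 T :=
      fun s => hfin.mem_toFinset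
    refine ⟨hfin.toFinset, _, fun τ hτ => pos_of_mem_jumpTimes ((hJ τ).1 hτ).1,
      hX.isStepLipschitz_dynkinMartingale hθ hF T ω hJ, fun t ht => ?_⟩
    rw [tsum_Icc_eq_sum (J := hfin.toFinset) (g := fun s : ℝ≥0 =>
      stieltjesJump θ (fun u => X u ω) (ζ s) s * σ (stieltjesJump θ (fun u => X u ω) (ζ s) s))]
    · refine Finset.sum_congr rfl fun τ hτ => ?_
      have hτT : (τ : ℝ) ∈ Set.Icc 0 (T : ℝ) := ⟨τ.coe_nonneg, ((hJ τ).1 hτ).2.2⟩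
      have hj : stieltjesJump θ (fun u => X u ω) (ζ τ) τ =
          jumpAt (fun y : chamber n θ => stieltjesAlong (n := n) θ T ζ τ y) (fun t => X t ω) τ := by
        rw [stieltjesJump_eq_jumpAt]
        simp only [stieltjesAlong, clampCurve_of_mem hτT]
      rw [hj, unitStep]
      split_ifs <;> simp
    · intro s hs hsJ
      rw [stieltjesJump_of_notMem _ fun h => hsJ ((hJ s).2 ⟨h, zero_le, hs.trans ht⟩), zero_mul]
  refine isQuadraticCovariation_of_hasCovariation P hMm (fun t ht => hσm.comp (hMm t ht))
    (fun ω => ?_) (fun ω t ht => ?_) (fun ω t ht => ?_) (fun ω t ht => ?_)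
  all_goals obtain ⟨J, α, hpos, hstep, hV⟩ := key ω
  · exact (hstep.hasCovariation hpos (hσ J _ _ hstep)).congr (fun _ _ => rfl) (fun _ _ => rfl) hV
  · exact hstep.rightContinuous ht
  · exact (hσ J _ _ hstep).rightContinuous ht
  · refine IsStepLipschitz.rightContinuous (J := J) (α := fun τ => α τ * σ (α τ)) ?_ ht
    exact ⟨fun _ => 0, 0, le_rfl, fun s t _ => by simp, fun t ht => by
      beta_reduce
      rw [hV t ht, zero_add]⟩

end Characteristic

end BetaWalk

end

/-! ### The stochastic equation along the characteristic. -/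

theorem proposition2p8 {Ω : Type*} {mΩ : MeasurableSpace Ω} (P : Measure Ω)
    [IsProbabilityMeasure P] (ℱ : Filtration ℝ≥0 mΩ)
    (n : ℕ) (hn : 0 < n) (θ : ℝ) (hθ : 0 < θ)
    (X : ℝ≥0 → Ω → BetaWalk.chamber n θ) (hX : BetaWalk.IsWalk θ P ℱ X)
    (μ : ℝ≥0 → ProbabilityMeasure ℝ) (hμ : BetaWalk.IsLimitFlow μ)
    (T : ℝ≥0) (z : ℂ) (ζ : ℝ → ℂ) (hζ : BetaWalk.IsCharacteristic μ T z ζ) :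
    ∃ M : ℝ≥0 → Ω → ℂ,
      -- the integrals in the equation exist
      (∀ ω, IntervalIntegrable
        (fun s : ℝ => deriv (BetaWalk.stieltjes (BetaWalk.empirical (n := n) θ (X s.toNNReal ω))) (ζ s) *
          Complex.exp (-BetaWalk.stieltjes (μ s.toNNReal) (ζ s))) volume 0 T) ∧
      (∀ ω, IntervalIntegrable
        (fun s : ℝ => BetaWalk.nekrasovDrift (n := n) θ (X s.toNNReal ω) (ζ s)) volume 0 T) ∧
      -- the stochastic equation on `[0, T]`
      (∀ ω, ∀ t ≤ T,
        BetaWalk.stieltjes (BetaWalk.empirical (n := n) θ (X t ω)) (ζ t) =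
          BetaWalk.stieltjes (BetaWalk.empirical (n := n) θ (X 0 ω)) z
          + (∫ s in (0 : ℝ)..t,
              deriv (BetaWalk.stieltjes (BetaWalk.empirical (n := n) θ (X s.toNNReal ω))) (ζ s) *
                Complex.exp (-BetaWalk.stieltjes (μ s.toNNReal) (ζ s)))
          + (∫ s in (0 : ℝ)..t, BetaWalk.nekrasovDrift (n := n) θ (X s.toNNReal ω) (ζ s))
          + M t ω) ∧
      -- `M` is a martingale on `[0, T]` (written as the martingale frozen at `T`) starting at `0`
      Martingale (fun t => M (min t T)) ℱ P ∧
      (∀ ω, M 0 ω = 0) ∧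
      -- the quadratic variations; the sums over jump times converge absolutely
      (∀ ω, Summable
        (fun s : Set.Icc (0 : ℝ≥0) T =>
          ‖BetaWalk.stieltjesJump θ (fun u => X u ω) (ζ (s : ℝ≥0)) s‖ ^ 2)) ∧
      BetaWalk.IsQuadraticCovariation P T M M
        (fun t ω => ∑' s : Set.Icc (0 : ℝ≥0) t,
          BetaWalk.stieltjesJump θ (fun u => X u ω) (ζ (s : ℝ≥0)) s ^ 2) ∧
      BetaWalk.IsQuadraticCovariation P T M (fun t ω => (starRingEnd ℂ) (M t ω))
        (fun t ω => ((∑' s : Set.Icc (0 : ℝ≥0) t,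
          ‖BetaWalk.stieltjesJump θ (fun u => X u ω) (ζ (s : ℝ≥0)) s‖ ^ 2 : ℝ) : ℂ)) := by
  obtain ⟨c, hc, hcζ⟩ := hζ.exists_le_abs_im
  have hF := hζ.isTestFamily n θ hc hcζ
  -- The interval is half-open because the clamped curve is constant after T, so its right
  -- derivative at T is 0 instead of the characteristic velocity. The integrals do not see this
  -- endpoint.
  have hD : ∀ ω, Set.EqOn
      (fun s : ℝ => BetaWalk.timeDeriv (BetaWalk.stieltjesAlong (n := n) θ T ζ) s (X s.toNNReal ω))
      (fun s : ℝ => deriv (BetaWalk.stieltjes (BetaWalk.empirical (n := n) θ (X s.toNNReal ω))) (ζ s) *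
          Complex.exp (-BetaWalk.stieltjes (μ s.toNNReal) (ζ s))) (Set.Ico 0 (T : ℝ)) :=
    fun ω s hs => hζ.timeDeriv_stieltjesAlong θ (X s.toNNReal ω).1 hs
  have hG : ∀ ω, Set.EqOn
      (fun s : ℝ =>
        BetaWalk.complexGenerator θ (BetaWalk.stieltjesAlong (n := n) θ T ζ s) (X s.toNNReal ω))
      (fun s : ℝ => BetaWalk.nekrasovDrift (n := n) θ (X s.toNNReal ω) (ζ s))
      (Set.Ico 0 (T : ℝ)) := fun ω s hs =>
    hζ.complexGenerator_stieltjesAlong hn hθ (X _ ω).2 ⟨hs.1, hs.2.le⟩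
  have hsub : ∀ t ≤ T, Set.uIoo (0 : ℝ) t ⊆ Set.Ico 0 (T : ℝ) := fun t ht s hs => by
    rw [Set.uIoo_of_le t.coe_nonneg] at hs
    exact ⟨hs.1.le, hs.2.trans_le ht⟩
  refine ⟨BetaWalk.dynkinMartingale θ X (BetaWalk.stieltjesAlong (n := n) θ T ζ), ?_, ?_, ?_, ?_, ?_, ?_, ?_,
    ?_⟩
  · intro ω
    exact (hX.intervalIntegrable (G := BetaWalk.timeDeriv (BetaWalk.stieltjesAlong (n := n) θ T ζ))
      BetaWalk.IsTestFamily.measurable_timeDeriv (fun s x _ => hF.norm_timeDeriv_le s x) ω 0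
      T).congr_uIoo ((hD ω).mono (hsub T le_rfl))
  · intro ω
    exact (hX.intervalIntegrable
      (G := fun s => BetaWalk.complexGenerator θ (BetaWalk.stieltjesAlong (n := n) θ T ζ s))
      hF.measurable_generator
      (fun s x hx => BetaWalk.norm_complexGenerator_le hθ (hF.norm_le s) hx) ω 0
      T).congr_uIoo ((hG ω).mono (hsub T le_rfl))
  · intro ω t ht
    have h0 : BetaWalk.stieltjesAlong (n := n) θ T ζ 0 (X 0 ω) =
        BetaWalk.stieltjes (BetaWalk.empirical (n := n) θ (X 0 ω)) z := by
      rw [BetaWalk.stieltjesAlong, BetaWalk.clampCurve_of_mem ⟨le_rfl, T.coe_nonneg⟩, hζ.zero]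
    have ht' : BetaWalk.stieltjesAlong (n := n) θ T ζ t (X t ω) =
        BetaWalk.stieltjes (BetaWalk.empirical (n := n) θ (X t ω)) (ζ t) := by
      rw [BetaWalk.stieltjesAlong, BetaWalk.clampCurve_of_mem ⟨t.coe_nonneg, ht⟩]
    rw [hX.dynkinMartingale_eq hθ hF, h0, ht',
      intervalIntegral.integral_congr_uIoo ((hD ω).mono (hsub t ht)),
      intervalIntegral.integral_congr_uIoo ((hG ω).mono (hsub t ht))]
    ring
  · exact BetaWalk.martingale_stopped (hX.martingale_dynkin hθ hF) T
  · intro ω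
    simp [BetaWalk.dynkinMartingale]
  · intro ω
    have hfin := (hX.cadlag ω).finite_jumpTimes T
    refine summable_of_hasFiniteSupport
      ((hfin.preimage (f := fun s : Set.Icc (0 : ℝ≥0) T => (s : ℝ≥0))
        Subtype.val_injective.injOn).subset fun s hs => ⟨?_, s.2⟩)
    by_contra hm
    exact hs (by simp [BetaWalk.stieltjesJump_of_notMem _ hm])
  · have h := hX.isQuadraticCovariation_stieltjes hθ hF id measurable_id fun _ _ _ h => h
    simpa only [id, ← sq] using h
  · have h := hX.isQuadraticCovariation_stieltjes hθ hF (starRingEnd ℂ)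
      Complex.continuous_conj.measurable fun _ _ _ h => h.conj
    simpa only [Complex.ofReal_tsum, Complex.ofReal_pow, Complex.mul_conj'] using h
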